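/- **Setting.** Let $\Omega=\mathrm{BUC}(\mathbb R)$ be the space of bounded uniformly continuous functions $V:\mathbb R\to\mathbb R$, with the $\sigma$-algebra $\mathcal F$ generated by the evaluations $V\mapsto V(x)$, $x\in\mathbb R$, and the translations $(T_yV)(x)=V(x+y)$. Let $\overline m>0$ and let $\mathbb P$ be a probability measure on $(\Omega,\mathcal F)$ such that * almost surely $\operatorname{ess\,sup}_{\mathbb R} V=0$ and $\operatorname{ess\,sup}_{\mathbb R}(-V)=\overline m$; * $\mathbb P[T_yE]=\mathbb P[E]$ for all $E\in\mathcal F$, $y\in\mathbb R$ (stationarity); * $\mathbb P\big[\bigcap_{z\in\mathbb R}T_zE\big]\in\{0,1\}$ for all $E\in\mathcal F$ for which this intersection is in $\mathcal F$ (ergodicity); * almost surely $V\in C^\infty(\mathbb R)$ and no level set of $V$ has a cluster point. For a continuous coercive $G:\mathbb R\to\mathbb R$ (that is, $G(q)\to+\infty$ as $|q|\to\infty$), call $(G,V)$ *regularly homogenizable* with *effective Hamiltonian* $\overline G:\mathbb R\to\mathbb R$ if for every $p\in\mathbb R$ and every $R>0$, almost surely, $$\lim_{\lambda\to0^+}\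 \max_{|y|\le R/\lambda}\big|\lambda v_\lambda(y,p)+\overline G(p)\big|=0,$$ where $v_\lambda(\cdot,p)$ is the unique bounded continuous viscosity solution of $\lambda v_\lambda+G(p+v_\lambda')+V(y)=0$ in $\mathbb R$. Let $H:\mathbb R\to[0,\infty)$ be Lipschitz and coercive with $H(0)=0$, strictly decreasing on $(-\infty,0]$, and let $p_1>p_2>\dots>p_{2L}>p_{2L+1}=0$ be such that $H$ is strictly increasing on $[p_1,\infty)$ and on $[p_{2i+1},p_{2i}]$, and strictly decreasing on $[p_{2i},p_{2i-1}]$, for $1\le i\le L$, and such that $H(p_1),\dots,H(p_{2L})$ are distinct positive numbers. Put $m_i=H(p_{2i-1})$ and $M_i=H(p_{2i})$ for $1\le i\le L$, and let $k,l\in\{1,\dots,L\}$ be such that $M_k=\max_i M_i$ and $m_l=\min_i m_i$. Assume $$\overline m<M_k-m_l\qquad\text{and}\qquad l\le k .$$ Let $H_1:\mathbb R\to[0,\infty)$ and $H_2:\mathbb R\to[m_l,\infty)$ be coercive Lipschitz functions with $H_1\ge H$, $H_2\ge H$ and * $H_1=H$ on $(-\infty,p_{2k}]$, and $H_1$ is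 strictly increasing on $(p_{2k},\infty)$; * $H_2=H$ on $[p_{2k},\infty)$, and $H_2$ is strictly decreasing on $(-\infty,p_{2k})$. **Lemma.** If $(H_1,V)$ and $(H_2,V)$ are regularly homogenizable, then $(H,V)$ is regularly homogenizable and $$\overline H(p)=\begin{cases}\overline H_1(p)& p\le 0,\\ \min\{\overline H_1(p),\overline H_2(p),M_k-\overline m\}& 0\le p\le p_{2l-1},\\ \overline H_2(p)& p\ge p_{2l-1}.\end{cases}$$ Moreover, $\overline H$ has a flat piece at level $M_k-\overline m$: there are $0\le q_1<q_2\le p_{2l-1}$ with $\overline H= M_k-\overline m$ on $[q_1,q_2]$. -/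

import Mathlib

open Set Filter Topology MeasureTheory
open scoped ContDiff

namespace HJ

/-- The space of real-valued, bounded and uniformly continuous functions on `ℝ`. -/
def BUC : Type := {V : ℝ → ℝ // (∃ C, ∀ x, |V x| ≤ C) ∧ UniformContinuous V}

instance : CoeFun BUC (fun _ => ℝ → ℝ) := ⟨fun V => V.1⟩

/-- The `σ`-algebra on `BUC` generated by the evaluations `V ↦ V x`, `x ∈ ℝ`. -/
instance : MeasurableSpace BUC :=
  ⨆ x : ℝ, MeasurableSpace.comap (fun V : BUC => V x) (borel ℝ)

/-- The translation `(T_y V)(x) = V (x + y)`. -/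
def translate (y : ℝ) (V : BUC) : BUC :=
  ⟨fun x => V (x + y), by
    obtain ⟨⟨C, hC⟩, hV⟩ := V.2
    exact ⟨⟨C, fun x => hC (x + y)⟩, hV.comp (uniformContinuous_id.add uniformContinuous_const)⟩⟩

/-- The standing assumptions on the law of the random potential: its values fill the range
`[-mbar, 0]`, and it is stationary and ergodic with respect to translations. -/
structure IsAdmissibleLaw (P : Measure BUC) (mbar : ℝ) : Prop where
  prob : IsProbabilityMeasure P
  mbar_pos : 0 < mbar
  esssup_eq : ∀ᵐ V ∂P, essSup (fun x => V x) volume = 0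
  esssup_neg_eq : ∀ᵐ V ∂P, essSup (fun x => -V x) volume = mbar
  stationary : ∀ E : Set BUC, MeasurableSet E → ∀ y : ℝ, P (translate y '' E) = P E
  /-- An uncountable intersection of events need not be an event, so only those intersections
  are considered that are. -/
  ergodic : ∀ E : Set BUC, MeasurableSet E → MeasurableSet (⋂ z : ℝ, translate z '' E) →
    P (⋂ z : ℝ, translate z '' E) = 0 ∨ P (⋂ z : ℝ, translate z '' E) = 1

/-- `H(q) → +∞` as `|q| → ∞`. -/
def Coercive (H : ℝ → ℝ) : Prop := Tendsto H (cocompact ℝ) atTop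

/-- Viscosity subsolutions of `F(y, v, v') = 0` in `ℝ`. -/
def IsViscositySubsolution (F : ℝ → ℝ → ℝ → ℝ) (v : ℝ → ℝ) : Prop :=
  ∀ φ : ℝ → ℝ, ContDiff ℝ 1 φ → ∀ y : ℝ, IsLocalMax (fun x => v x - φ x) y →
    F y (v y) (deriv φ y) ≤ 0

/-- Viscosity supersolutions of `F(y, v, v') = 0` in `ℝ`. -/
def IsViscositySupersolution (F : ℝ → ℝ → ℝ → ℝ) (v : ℝ → ℝ) : Prop :=
  ∀ φ : ℝ → ℝ, ContDiff ℝ 1 φ → ∀ y : ℝ, IsLocalMin (fun x => v x - φ x) y →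
    0 ≤ F y (v y) (deriv φ y)

/-- `v` is a bounded continuous viscosity solution of
`lam * v + H (p + v') + V(y) = 0` in `ℝ`. -/
structure IsCellSolution (H : ℝ → ℝ) (V : BUC) (p lam : ℝ) (v : ℝ → ℝ) : Prop where
  continuous : Continuous v
  bounded : ∃ C, ∀ y, |v y| ≤ C
  sub : IsViscositySubsolution (fun y r q => lam * r + H (p + q) + V y) v
  super : IsViscositySupersolution (fun y r q => lam * r + H (p + q) + V y) v

/-- `(H, V)` is regularly homogenizable at `p` with respect to `P`, and `c` is the value of the
effective Hamiltonian at `p`. -/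
structure RegularlyHomogenizableAt (P : Measure BUC) (H : ℝ → ℝ) (p c : ℝ) : Prop where
  law : ∃ mbar : ℝ, IsAdmissibleLaw P mbar
  continuous : Continuous H
  coercive : Coercive H
  /-- the solution `v_lam` of the cell problem is well defined -/
  wellPosed : ∀ V : BUC, ∀ lam : ℝ, 0 < lam → ∃! v : ℝ → ℝ, IsCellSolution H V p lam v
  /-- the maximum of `|lam * v_lam + c|` over `[-R/lam, R/lam]` tends to `0` as `lam → 0+` -/
  tendsto : ∀ R : ℝ, 0 < R → ∀ᵐ V ∂P, ∀ v : ℝ → ℝ → ℝ,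
    (∀ lam : ℝ, 0 < lam → IsCellSolution H V p lam (v lam)) →
    Tendsto (fun lam : ℝ =>
      sSup ((fun y : ℝ => |lam * v lam y + c|) '' Icc (-(R / lam)) (R / lam))) (𝓝[>] 0) (𝓝 0)

/-- `(H, V)` is regularly homogenizable, with effective Hamiltonian `Hbar`. -/
def IsEffectiveHamiltonian (P : Measure BUC) (H Hbar : ℝ → ℝ) : Prop :=
  ∀ p : ℝ, RegularlyHomogenizableAt P H p (Hbar p)

/-- The effective Hamiltonian is unique. -/
theorem IsEffectiveHamiltonian.unique {P : Measure BUC} {H Hbar Hbar2 : ℝ → ℝ}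
    (h : IsEffectiveHamiltonian P H Hbar) (h2 : IsEffectiveHamiltonian P H Hbar2) :
    Hbar = Hbar2 := by
  funext p
  obtain ⟨_, hlaw⟩ := (h p).law
  have := hlaw.prob
  obtain ⟨V, hV, hV2⟩ :=
    (((h p).tendsto 1 one_pos).and ((h2 p).tendsto 1 one_pos)).exists
  choose! v hv _ using (h p).wellPosed V
  have key : ∀ c : ℝ, Tendsto (fun lam : ℝ =>
      sSup ((fun y : ℝ => |lam * v lam y + c|) '' Icc (-(1 / lam)) (1 / lam))) (𝓝[>] 0) (𝓝 0) →
      Tendsto (fun lam : ℝ => lam * v lam 0 + c) (𝓝[>] 0) (𝓝 0) := by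
    intro c hc
    refine squeeze_zero_norm' ?_ hc
    filter_upwards [self_mem_nhdsWithin] with lam hlam
    have hlam : 0 < lam := hlam
    have hcont := (hv lam hlam).continuous
    have hpos : 0 < 1 / lam := by positivity
    exact le_csSup (isCompact_Icc.image (by fun_prop)).bddAbove
      ⟨0, ⟨by linarith, hpos.le⟩, rfl⟩
  have e := (key _ (hV v hv)).sub (key _ (hV2 v hv))
  have e2 : Tendsto (fun _ : ℝ => Hbar p - Hbar2 p) (𝓝[>] (0 : ℝ)) (𝓝 (0 - 0)) := by
    refine e.congr fun lam => ?_
    ring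
  have := tendsto_nhds_unique e2 tendsto_const_nhds
  linarith

/-- The shape of the Hamiltonian: `H` is Lipschitz, coercive and nonnegative, `H 0 = 0`, it is
strictly decreasing on `(-∞, 0]`, and on `[0, ∞)` it has exactly `L` wells and `L` bumps, at the
points `pt 1 > pt 2 > ... > pt (2 * L) > pt (2 * L + 1) = 0`. The odd points are the local minima
and the even points the local maxima. Only the values `pt 1, ..., pt (2 * L + 1)` matter. -/
structure IsWellProfile (H : ℝ → ℝ) (L : ℕ) (pt : ℕ → ℝ) : Prop where
  lipschitz : ∃ K, LipschitzWith K H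
  coercive : Coercive H
  nonneg : ∀ q, 0 ≤ H q
  map_zero : H 0 = 0
  pt_anti : StrictAntiOn pt (Icc 1 (2 * L + 1))
  pt_last : pt (2 * L + 1) = 0
  mono_right : StrictMonoOn H (Ici (pt 1))
  mono : ∀ i ∈ Icc 1 L, StrictMonoOn H (Icc (pt (2 * i + 1)) (pt (2 * i)))
  anti : ∀ i ∈ Icc 1 L, StrictAntiOn H (Icc (pt (2 * i)) (pt (2 * i - 1)))
  anti_left : StrictAntiOn H (Iic 0)
  values_pos : ∀ j ∈ Icc 1 (2 * L), 0 < H (pt j)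
  values_injOn : InjOn (fun j => H (pt j)) (Icc 1 (2 * L))

/-- Almost every potential is smooth, and its level sets have no cluster points. -/
def HasDiscreteLevels (P : Measure BUC) : Prop :=
  ∀ᵐ V ∂P, ContDiff ℝ ∞ (fun x => V x) ∧ ∀ c y : ℝ, ¬ AccPt y (𝓟 {x : ℝ | V x = c})

end HJ

open HJ

namespace HJ

/-! ### Continuous functions on an interval -/

/-! Write `b` for the point of the highest bump, of height `M_k`, and `a` for the point of the
lowest well; `l ≤ k` means `0 < b < a`. Let `v`, `w₁`, `w₂` solve the cell problems of `H`, `H₁`,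
`H₂`. Since `λ v` should converge to minus the effective Hamiltonian, lower bounds for `λ v` are
upper bounds for the latter.

Lower bounds for `v`. As `H ≤ H₁, H₂`, comparison gives `w₁, w₂ ≤ v`. For `0 < p < a` there is a
third bound: a tent whose total gradients `p + s'` are `a` to the left and `0` to the right of a
point `z` where `V` is nearly `-mbar`. On its sides `H` is at most `m_l < M_k - mbar`; at its tip
all gradients in `[0, a]` occur, but there `H + V ≤ M_k + V z`, which is nearly `M_k - mbar`. Such
`z` exist within `o(1/λ)` of every point on the scale `1/λ`, by recurrence with a quantitative bound
on return times (`ae_hasDenseMinima`). Hence `λ v` is asymptotically at least `-(M_k - mbar)`.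

Upper bounds for `v`. Where `λ v > -(M_k - mbar)`, no line of total gradient `b` touches `v` from
above, since the equation would give `λ v ≤ -H b - V ≤ -(M_k - mbar)`. So gradients cross `b` at
most once, upwards. For `p < b`, at a penalized maximum of `v - w₁` the gradient lies below `b`, as
otherwise `v` would climb away from the asymptotically flat `w₁`. There `H = H₁`, and comparison
gives `v ≲ w₁` (`scaledLimsupLE_of_lt_barrier`). For `p < 0` the alternative `λ v ≲ -(M_k - mbar)`
is removed by the well at `0`: if `λ v < 0 = -H 0`, no line of total gradient `0` touches from
below, so gradients cross `0` only downwards, and boundedness of `λ v` puts this crossing far to the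
left (`scaledLimsupLE_of_lt_well`). Reflection in space treats `p > b` and `p > a` with `H₂` and the
well at `a`.

Flat piece. On `p ≤ b` constants give `Hbar₂ ≥ M_k - mbar`, so it suffices that `Hbar₁ ≥ M_k - mbar`
on an interval to the left of `b`. Otherwise, for some `p` arbitrarily close to `b`, all gradients
stay below `b`, and below it by a fixed amount wherever `V ≥ -mbar/2`. As the mean gradient is `p`,
this forces `V ≥ -mbar/2` to occur with density zero, contradicting `ess sup V = 0` and stationarity
(`exists_le_left_of_barrier`). -/

theorem exists_antitoneOn_monotoneOn {g : ℝ → ℝ} {a b : ℝ} (hab : a ≤ b)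
    (hg : ContinuousOn g (Icc a b)) (hmax : ∀ y ∈ Ioo a b, ¬ IsLocalMax g y) :
    ∃ z ∈ Icc a b, AntitoneOn g (Icc a z) ∧ MonotoneOn g (Icc z b) := by
  obtain ⟨z, hz, hzmin⟩ := isCompact_Icc.exists_isMinOn (nonempty_Icc.2 hab) hg
  -- A strict rise followed by a strict fall would enclose a local maximum.
  have key : ∀ x y w, a ≤ x → x < y → y < w → w ≤ b → g x < g y → g w < g y → False := by
    intro x y w hax hxy hyw hwb h1 h2
    obtain ⟨t, ht, htmax⟩ := isCompact_Icc.exists_isMaxOn (nonempty_Icc.2 (hxy.trans hyw).le)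
      (hg.mono (Icc_subset_Icc hax hwb))
    have hy : g y ≤ g t := htmax ⟨hxy.le, hyw.le⟩
    have h3 : x < t := lt_of_le_of_ne ht.1 (by rintro rfl; linarith)
    have h4 : t < w := lt_of_le_of_ne ht.2 (by rintro rfl; linarith)
    exact hmax t ⟨by linarith, by linarith⟩ (htmax.isLocalMax (Icc_mem_nhds h3 h4))
  refine ⟨z, hz, ?_, ?_⟩
  · intro x hx y hy hxy
    by_contra! h
    have hzx : g z ≤ g x := hzmin ⟨hx.1, hx.2.trans hz.2⟩
    have hxy' : x < y := lt_of_le_of_ne hxy (by rintro rfl; exact lt_irrefl _ h)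
    have hyz : y < z := lt_of_le_of_ne hy.2 (by rintro rfl; linarith)
    exact key x y z hx.1 hxy' hyz hz.2 h (by linarith)
  · intro x hx y hy hxy
    by_contra! h
    have hzx : g z ≤ g y := hzmin ⟨hz.1.trans hy.1, hy.2⟩
    have hxy' : x < y := lt_of_le_of_ne hxy (by rintro rfl; exact lt_irrefl _ h)
    have hyz : z < x := lt_of_le_of_ne hx.1 (by rintro rfl; linarith)
    exact key z x y hz.1 hyz hxy' hy.2 (by linarith) h

theorem exists_monotoneOn_antitoneOn {g : ℝ → ℝ} {a b : ℝ} (hab : a ≤ b)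
    (hg : ContinuousOn g (Icc a b)) (hmin : ∀ y ∈ Ioo a b, ¬ IsLocalMin g y) :
    ∃ z ∈ Icc a b, MonotoneOn g (Icc a z) ∧ AntitoneOn g (Icc z b) := by
  obtain ⟨z, hz, h1, h2⟩ := exists_antitoneOn_monotoneOn (g := fun x => - g x) hab hg.neg
    (fun y hy h => hmin y hy (by simpa using h.neg))
  exact ⟨z, hz, fun x hx y hy hxy => neg_le_neg_iff.1 (h1 hx hy hxy),
    fun x hx y hy hxy => neg_le_neg_iff.1 (h2 hx hy hxy)⟩

/-- If every test function touching `u` from above has slope at most `q`, then `u - q x` is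
nonincreasing. -/
theorem antitoneOn_sub_of_test_le {u : ℝ → ℝ} (hu : Continuous u) {a b q : ℝ}
    (h : ∀ φ : ℝ → ℝ, ContDiff ℝ 1 φ → ∀ y ∈ Ioo a b, IsLocalMax (fun x => u x - φ x) y →
      deriv φ y ≤ q) :
    AntitoneOn (fun x => u x - q * x) (Icc a b) := by
  have key : ∀ x y, a ≤ x → x < y → y < b → u y - q * y ≤ u x - q * x := by
    intro x y hax hxy hyb
    by_contra! hlt
    set m := (u y - q * y - (u x - q * x)) with hm
    have hm0 : 0 < m := by linarith
    -- Tilting by `e` spends half of the rise `m`; the exponential, of size `s = m / 4` at `y`,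
    -- leaves `m / 4`. So the maximum of `u - φ` is interior, with slope greater than `q + e`.
    set e := m / (2 * (y - x)) with he
    have hyx : 0 < y - x := by linarith
    have he0 : 0 < e := by positivity
    have hey : e * (y - x) = m / 2 := by rw [he]; field_simp
    set s := m / 4 with hs
    have hs0 : 0 < s := by positivity
    -- a steep exponential keeps the maximum away from the right end point
    set A := |u b - (q + e) * b - (u x - (q + e) * x)| + 1 with hA
    have hA0 : 0 < A := by positivity
    set B := A / (s * (b - y)) with hB
    have hby : 0 < b - y := by linarith
    have hB0 : 0 < B := by positivity
    set φ : ℝ → ℝ := fun t => (q + e) * t + s * Real.exp (B * (t - y)) with hφ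
    have hφc : ContDiff ℝ 1 φ := by
      rw [hφ]; fun_prop
    have hd : ∀ t, deriv φ t = (q + e) + s * (Real.exp (B * (t - y)) * B) := by
      intro t
      have h1 : HasDerivAt (fun t : ℝ => B * (t - y)) B t := by
        simpa using ((hasDerivAt_id t).sub_const y).const_mul B
      have h2 : HasDerivAt φ _ t := ((hasDerivAt_id t).const_mul (q + e)).add (h1.exp.const_mul s)
      simpa using h2.deriv
    obtain ⟨t, ht, htmax⟩ := isCompact_Icc.exists_isMaxOn (nonempty_Icc.2 (hxy.trans hyb).le)
      (f := fun x => u x - φ x) (hu.sub hφc.continuous).continuousOn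
    have hty : u y - φ y ≤ u t - φ t := htmax ⟨hxy.le, hyb.le⟩
    have hφy : φ y = (q + e) * y + s := by simp [hφ]
    have hφx : (q + e) * x ≤ φ x := by
      simp only [hφ]; have := Real.exp_pos (B * (x - y)); nlinarith
    have hφb : (q + e) * b + A ≤ φ b := by
      simp only [hφ]
      have h1 : B * (b - y) + 1 ≤ Real.exp (B * (b - y)) := Real.add_one_le_exp _
      have h2 : s * (B * (b - y)) = A := by rw [hB]; field_simp
      nlinarith
    have hgt : u x - (q + e) * x < u y - φ y := by
      rw [hφy]; nlinarith
    have h3 : x < t := lt_of_le_of_ne ht.1 (by rintro rfl; linarith)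
    have h4 : t < b := by
      refine lt_of_le_of_ne ht.2 (by
        rintro rfl
        have := le_abs_self (u t - (q + e) * t - (u x - (q + e) * x))
        linarith)
    have h5 := h φ hφc t ⟨by linarith, h4⟩ (htmax.isLocalMax (Icc_mem_nhds h3 h4))
    rw [hd] at h5
    have : 0 < s * (Real.exp (B * (t - y)) * B) := by positivity
    linarith
  intro x hx y hy hxy
  rcases hxy.eq_or_lt with rfl | hxy
  · exact le_rfl
  rcases hy.2.eq_or_lt with rfl | hyb
  · have hcont : Tendsto (fun t => u t - q * t) (𝓝[<] y) (𝓝 (u y - q * y)) :=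
      ((by fun_prop : Continuous fun t => u t - q * t).tendsto y).mono_left inf_le_left
    refine le_of_tendsto hcont ?_
    filter_upwards [Ioo_mem_nhdsLT hxy] with t ht
    exact key x t hx.1 ht.1 ht.2
  · exact key x y hx.1 hxy hyb

theorem isLocalMax_comp_neg {f : ℝ → ℝ} {y : ℝ} (h : IsLocalMax f y) :
    IsLocalMax (fun x => f (-x)) (-y) := by
  have : Tendsto (fun x : ℝ => -x) (𝓝 (-y)) (𝓝 y) := by
    simpa using (continuous_neg.tendsto (-y))
  have h' := this.eventually h
  simpa [IsLocalMax, IsMaxFilter] using h'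

theorem isLocalMin_comp_neg {f : ℝ → ℝ} {y : ℝ} (h : IsLocalMin f y) :
    IsLocalMin (fun x => f (-x)) (-y) := by
  have : Tendsto (fun x : ℝ => -x) (𝓝 (-y)) (𝓝 y) := by
    simpa using (continuous_neg.tendsto (-y))
  have h' := this.eventually h
  simpa [IsLocalMin, IsMinFilter] using h'

/-- The one-sided bound is applied to `u` and to its reflection. With coercivity this makes
subsolutions Lipschitz. -/
theorem abs_sub_le_of_test_le {u : ℝ → ℝ} (hu : Continuous u) {K : ℝ}
    (h : ∀ φ : ℝ → ℝ, ContDiff ℝ 1 φ → ∀ y, IsLocalMax (fun x => u x - φ x) y →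
      |deriv φ y| ≤ K) (x y : ℝ) : |u x - u y| ≤ K * |x - y| := by
  have h1 : ∀ x y, x ≤ y → u y - u x ≤ K * (y - x) := by
    intro x y hxy
    have := antitoneOn_sub_of_test_le hu (a := x) (b := y) (q := K)
      (fun φ hφ t _ ht => (le_abs_self _).trans (h φ hφ t ht))
      (left_mem_Icc.2 hxy) (right_mem_Icc.2 hxy) hxy
    simp only at this; linarith
  have h2 : ∀ x y, x ≤ y → u x - u y ≤ K * (y - x) := by
    intro x y hxy
    have := antitoneOn_sub_of_test_le (u := fun x => u (-x)) (hu.comp continuous_neg)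
      (a := -y) (b := -x) (q := K)
      (fun φ hφ t _ ht => by
        have h3 := h (fun x => φ (-x)) (hφ.comp contDiff_neg) (-t)
          (by simpa using isLocalMax_comp_neg ht)
        rw [deriv_comp_neg, neg_neg, abs_neg] at h3
        exact (le_abs_self _).trans h3)
      (left_mem_Icc.2 (neg_le_neg hxy)) (right_mem_Icc.2 (neg_le_neg hxy)) (neg_le_neg hxy)
    simp only [neg_neg] at this; linarith
  rcases le_total x y with hxy | hxy
  · rw [abs_sub_comm x y, abs_of_nonneg (sub_nonneg.2 hxy), abs_le]
    exact ⟨by linarith [h1 x y hxy], h2 x y hxy⟩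
  · rw [abs_of_nonneg (sub_nonneg.2 hxy), abs_le]
    exact ⟨by linarith [h2 y x hxy], h1 y x hxy⟩

/-! ### The comparison principle -/

/-- Doubling of variables: at a maximum of the doubled function the two test slopes differ only by
the slope of `Φ` and a vanishing term, and `G` is Lipschitz. The subsolution property is required
only near `y₀`; this allows `u` to solve an equation that agrees with that of `G` only there. -/
theorem local_comparison {G V u w Φ : ℝ → ℝ} {K p lam y₀ : ℝ}
    (hG : ∀ x y, |G x - G y| ≤ K * |x - y|) (hVc : Continuous V)
    (hu : Continuous u) (hw : Continuous w) (hΦ : ContDiff ℝ 1 Φ)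
    (hsub : ∀ᶠ y in 𝓝 y₀, ∀ φ : ℝ → ℝ, ContDiff ℝ 1 φ →
      IsLocalMax (fun x => u x - φ x) y → lam * u y + G (p + deriv φ y) + V y ≤ 0)
    (hsup : IsViscositySupersolution (fun y r q => lam * r + G (p + q) + V y) w)
    (hmax : IsLocalMax (fun x => u x - w x - Φ x) y₀) :
    lam * (u y₀ - w y₀) ≤ K * |deriv Φ y₀| := by
  obtain ⟨r, hr, hball⟩ := Metric.nhds_basis_closedBall.eventually_iff.1 (hsub.and hmax)
  set S := Metric.closedBall y₀ r with hS
  have hScomp : IsCompact (S ×ˢ S) :=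
    (isCompact_closedBall y₀ r).prod (isCompact_closedBall y₀ r)
  have hy0 : y₀ ∈ S := Metric.mem_closedBall_self hr.le
  -- The square centred at `y₀` makes the maximum strict, so that the maximum points of `F n`
  -- converge to `(y₀, y₀)`.
  set F : ℕ → ℝ × ℝ → ℝ := fun n z =>
    u z.1 - w z.2 - Φ z.1 - (z.1 - y₀) ^ 2 - n * (z.1 - z.2) ^ 2 with hF
  have hΦc := hΦ.continuous
  have hFc : ∀ n, Continuous (F n) := fun n => by simp only [hF]; fun_prop
  have hex : ∀ n, ∃ z ∈ S ×ˢ S, ∀ z' ∈ S ×ˢ S, F n z' ≤ F n z := fun n =>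
    hScomp.exists_isMaxOn ⟨(y₀, y₀), hy0, hy0⟩ (hFc n).continuousOn
  choose z hzS hzmax using hex
  obtain ⟨zl, hzl, σ, hσ, hlim⟩ := hScomp.tendsto_subseq hzS
  set f : ℝ → ℝ := fun x => u x - w x - Φ x with hf
  have hbase : ∀ n, f y₀ ≤ F n (z n) := fun n => by
    have := hzmax n (y₀, y₀) ⟨hy0, hy0⟩
    simpa [hF, hf] using this
  have hl1 : Tendsto (fun n => (z (σ n)).1) atTop (𝓝 zl.1) :=
    (continuous_fst.tendsto zl).comp hlim
  have hl2 : Tendsto (fun n => (z (σ n)).2) atTop (𝓝 zl.2) :=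
    (continuous_snd.tendsto zl).comp hlim
  have hσ' : Tendsto (fun n => ((σ n : ℕ) : ℝ)) atTop atTop :=
    tendsto_natCast_atTop_atTop.comp hσ.tendsto_atTop
  -- the limit lies on the diagonal
  have hdiag : zl.1 = zl.2 := by
    obtain ⟨B, hB⟩ := hScomp.bddAbove_image (hFc 0).continuousOn
    have h1 : ∀ n, (σ n : ℝ) * ((z (σ n)).1 - (z (σ n)).2) ^ 2 ≤ B - f y₀ := by
      intro n
      have h2 := hbase (σ n)
      have h3 : F 0 (z (σ n)) ≤ B := hB ⟨_, hzS _, rfl⟩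
      simp only [hF, Nat.cast_zero, zero_mul, sub_zero] at h2 h3
      linarith
    by_contra hne
    have h4 : 0 < (zl.1 - zl.2) ^ 2 := by
      have := sub_ne_zero.2 hne; positivity
    have h5 : Tendsto (fun n => (σ n : ℝ) * ((z (σ n)).1 - (z (σ n)).2) ^ 2) atTop atTop :=
      hσ'.atTop_mul_pos h4 ((hl1.sub hl2).pow 2)
    obtain ⟨n, hn⟩ := (h5.eventually_gt_atTop (B - f y₀)).exists
    exact absurd (h1 n) (not_le.2 hn)
  have hlimit : zl.1 = y₀ := by
    have h1 : ∀ n, f y₀ ≤ u (z (σ n)).1 - w (z (σ n)).2 - Φ (z (σ n)).1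
        - ((z (σ n)).1 - y₀) ^ 2 := by
      intro n
      have h2 := hbase (σ n)
      simp only [hF] at h2
      have : (0 : ℝ) ≤ (σ n : ℝ) * ((z (σ n)).1 - (z (σ n)).2) ^ 2 := by positivity
      linarith
    have h2 := ge_of_tendsto' (((((hu.tendsto _).comp hl1).sub ((hw.tendsto _).comp hl2)).sub
      ((hΦc.tendsto _).comp hl1)).sub ((hl1.sub_const y₀).pow 2)) h1
    rw [← hdiag] at h2
    have h3 : f zl.1 ≤ f y₀ := (hball hzl.1).2
    have h4 : (zl.1 - y₀) ^ 2 ≤ 0 := by simp only [hf] at *; linarith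
    nlinarith [sq_nonneg (zl.1 - y₀), pow_eq_zero_iff (two_ne_zero) |>.1
      (le_antisymm h4 (sq_nonneg _))]
  have hlimit2 : zl.2 = y₀ := hdiag ▸ hlimit
  rw [hlimit] at hl1
  rw [hlimit2] at hl2
  have hint : S ∈ 𝓝 y₀ := Metric.closedBall_mem_nhds y₀ hr
  have hineq : ∀ᶠ n in atTop, lam * (u (z (σ n)).1 - w (z (σ n)).2) ≤
      K * |deriv Φ (z (σ n)).1 + 2 * ((z (σ n)).1 - y₀)| +
        (V (z (σ n)).2 - V (z (σ n)).1) := by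
    filter_upwards [hl1.eventually (eventually_mem_nhds_iff.2 hint),
      hl2.eventually (eventually_mem_nhds_iff.2 hint)] with n h1 h2
    set N : ℝ := (σ n : ℝ)
    set x := (z (σ n)).1 with hx
    set y := (z (σ n)).2 with hy
    have hxS : x ∈ S := (hzS (σ n)).1
    have hyS : y ∈ S := (hzS (σ n)).2
    have hmx : ∀ x' ∈ S, ∀ y' ∈ S, u x' - w y' - Φ x' - (x' - y₀) ^ 2 - N * (x' - y') ^ 2 ≤
        u x - w y - Φ x - (x - y₀) ^ 2 - N * (x - y) ^ 2 := fun x' hx' y' hy' =>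
      hzmax (σ n) (x', y') ⟨hx', hy'⟩
    have hsq : ∀ c t : ℝ, HasDerivAt (fun s : ℝ => (s - c) ^ 2) (2 * (t - c)) t := fun c t => by
      simpa using ((hasDerivAt_id t).sub_const c).fun_pow 2
    have e1 := (hball hxS).1 (fun t => Φ t + (t - y₀) ^ 2 + N * (t - y) ^ 2)
      (by fun_prop) (by
        filter_upwards [h1] with t ht
        have := hmx t ht y hyS
        linarith)
    have d1 : deriv (fun t => Φ t + (t - y₀) ^ 2 + N * (t - y) ^ 2) x =
        deriv Φ x + 2 * (x - y₀) + N * (2 * (x - y)) :=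
      ((((hΦ.differentiable one_ne_zero) x).hasDerivAt.add (hsq y₀ x)).add
        ((hsq y x).const_mul N)).deriv
    have e2 := hsup (fun t => -(N * (t - x) ^ 2)) (by fun_prop) y (by
        filter_upwards [h2] with t ht
        have := hmx x hxS t ht
        have e3 : (x - t) ^ 2 = (t - x) ^ 2 := by ring
        have e4 : (x - y) ^ 2 = (y - x) ^ 2 := by ring
        rw [e3, e4] at this
        linarith)
    have d2 : deriv (fun t => -(N * (t - x) ^ 2)) y = N * (2 * (x - y)) := by
      rw [(((hsq x y).const_mul N).fun_neg).deriv]; ring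
    rw [d1] at e1
    simp only [d2] at e2
    have h3 := hG (p + N * (2 * (x - y)))
      (p + (deriv Φ x + 2 * (x - y₀) + N * (2 * (x - y))))
    have h4 : |p + N * (2 * (x - y)) - (p + (deriv Φ x + 2 * (x - y₀) + N * (2 * (x - y))))| =
        |deriv Φ x + 2 * (x - y₀)| := by
      rw [← abs_neg]; congr 1; ring
    rw [h4] at h3
    have h5 := (abs_le.1 h3).2
    linarith
  have hdc : Continuous (deriv Φ) := hΦ.continuous_deriv le_rfl
  have hL : Tendsto (fun n => lam * (u (z (σ n)).1 - w (z (σ n)).2)) atTop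
      (𝓝 (lam * (u y₀ - w y₀))) :=
    (((hu.tendsto _).comp hl1).sub ((hw.tendsto _).comp hl2)).const_mul lam
  have hR : Tendsto (fun n => K * |deriv Φ (z (σ n)).1 + 2 * ((z (σ n)).1 - y₀)| +
        (V (z (σ n)).2 - V (z (σ n)).1)) atTop
      (𝓝 (K * |deriv Φ y₀ + 2 * (y₀ - y₀)| + (V y₀ - V y₀))) :=
    (((((hdc.tendsto _).comp hl1).add ((hl1.sub_const y₀).const_mul 2)).abs).const_mul K).add
      (((hVc.tendsto _).comp hl2).sub ((hVc.tendsto _).comp hl1))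
  have := le_of_tendsto_of_tendsto hL hR hineq
  simpa using this

/-- A bounded function has a point of maximum after subtracting a smooth function of small slope;
the estimates are those of the scale `1 / lam`. -/
theorem exists_penalized_max {f : ℝ → ℝ} (hf : Continuous f) {C lam η : ℝ} (hlam : 0 < lam)
    (hη : 0 < η) (hC : ∀ y, |lam * f y| ≤ C) :
    ∃ (Φ : ℝ → ℝ) (y₀ : ℝ), ContDiff ℝ 1 Φ ∧ (∀ y, |deriv Φ y| ≤ η) ∧
      (∀ y, f y - Φ y ≤ f y₀ - Φ y₀) ∧ (∀ y, Φ y - Φ y₀ ≤ η * |y - y₀|) ∧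
      (∀ y, lam * (Φ y - Φ y₀) ≤ η * (1 + lam * |y|)) ∧ lam * |y₀| ≤ 1 + 2 * C / η := by
  -- A smooth version of `η * |y|`, rounded off at the scale `1 / lam`: it beats every bounded
  -- function at infinity, while `lam * Φ` is of order `η` on that scale.
  set Φ : ℝ → ℝ := fun y => η / lam * √(1 + (lam * y) ^ 2) with hΦ
  have hpos : ∀ y : ℝ, 0 < 1 + (lam * y) ^ 2 := fun y => by positivity
  have hcd : ContDiff ℝ 1 Φ := by
    simp only [hΦ]
    exact contDiff_const.mul (ContDiff.sqrt (by fun_prop) (fun y => (hpos y).ne'))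
  have hd : ∀ y, |deriv Φ y| ≤ η := by
    intro y
    have h1 : HasDerivAt (fun y : ℝ => 1 + (lam * y) ^ 2) (2 * (lam * y) * lam) y := by
      simpa using (((hasDerivAt_id y).const_mul lam).pow 2).const_add 1
    have h2 := (h1.sqrt (hpos y).ne').const_mul (η / lam)
    rw [h2.deriv]
    have h3 : η / lam * (2 * (lam * y) * lam / (2 * √(1 + (lam * y) ^ 2))) =
        η * ((lam * y) / √(1 + (lam * y) ^ 2)) := by field_simp
    rw [h3, abs_mul, abs_of_pos hη, abs_div, abs_of_nonneg (Real.sqrt_nonneg _)]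
    have h4 : |lam * y| ≤ √(1 + (lam * y) ^ 2) := Real.abs_le_sqrt (by linarith)
    have h5 : |lam * y| / √(1 + (lam * y) ^ 2) ≤ 1 := div_le_one_of_le₀ h4 (Real.sqrt_nonneg _)
    nlinarith
  have hlow : ∀ y, η * |y| ≤ Φ y := by
    intro y
    have h4 : |lam * y| ≤ √(1 + (lam * y) ^ 2) := Real.abs_le_sqrt (by linarith)
    rw [abs_mul, abs_of_pos hlam] at h4
    calc η * |y| = η / lam * (lam * |y|) := by field_simp
      _ ≤ _ := by simp only [hΦ]; gcongr
  have hup : ∀ y, lam * Φ y ≤ η * (1 + lam * |y|) := by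
    intro y
    have h4 : √(1 + (lam * y) ^ 2) ≤ 1 + lam * |y| := by
      apply Real.sqrt_le_iff.2 ⟨by positivity, ?_⟩
      have : (lam * y) ^ 2 = (lam * |y|) ^ 2 := by rw [mul_pow, mul_pow, sq_abs]
      rw [this]
      nlinarith [mul_nonneg hlam.le (abs_nonneg y)]
    have : lam * Φ y = η * √(1 + (lam * y) ^ 2) := by simp only [hΦ]; field_simp
    rw [this]; gcongr
  have hfb : ∀ y, |f y| ≤ C / lam := fun y => by
    rw [le_div_iff₀ hlam]
    have := hC y
    rw [abs_mul, abs_of_pos hlam] at this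
    linarith
  have hΦtop : Tendsto (fun y => -(f y - Φ y)) (cocompact ℝ) atTop := by
    have h1 : Tendsto (fun y : ℝ => η * ‖y‖ - C / lam) (cocompact ℝ) atTop :=
      tendsto_atTop_add_const_right _ _ ((tendsto_norm_cocompact_atTop).const_mul_atTop hη)
    refine tendsto_atTop_mono (fun y => ?_) h1
    have := (abs_le.1 (hfb y)).2
    have := hlow y
    rw [Real.norm_eq_abs]; linarith
  obtain ⟨y₀, hy₀⟩ := (by
    have := hcd.continuous
    fun_prop : Continuous fun y => -(f y - Φ y)).exists_forall_le hΦtop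
  have hmax : ∀ y, f y - Φ y ≤ f y₀ - Φ y₀ := fun y => neg_le_neg_iff.1 (hy₀ y)
  have hΦ0 : ∀ y, 0 ≤ Φ y := fun y => le_trans (by positivity) (hlow y)
  refine ⟨Φ, y₀, hcd, hd, hmax, fun y => ?_, fun y => ?_, ?_⟩
  · have := Convex.norm_image_sub_le_of_norm_deriv_le (f := Φ) (s := univ) (x := y₀) (y := y)
      (fun x _ => (hcd.differentiable one_ne_zero) x) (fun x _ => hd x) convex_univ trivial trivial
    exact (le_abs_self _).trans this
  · have := mul_nonneg hlam.le (hΦ0 y₀)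
    linarith [hup y, mul_sub lam (Φ y) (Φ y₀)]
  · have h1 := hmax 0
    have h2 := (abs_le.1 (hfb 0)).1
    have h3 := (abs_le.1 (hfb y₀)).2
    have h4 := hlow y₀
    have h5 := hup 0
    simp only [abs_zero, mul_zero, add_zero, mul_one] at h5
    have h6 : η * |y₀| ≤ 2 * (C / lam) + Φ 0 := by linarith
    have h7 : η * (lam * |y₀|) ≤ 2 * C + η := by
      calc η * (lam * |y₀|) = lam * (η * |y₀|) := by ring
        _ ≤ lam * (2 * (C / lam) + Φ 0) := by gcongr
        _ = 2 * C + lam * Φ 0 := by field_simp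
        _ ≤ _ := by linarith
    have h8 : lam * |y₀| ≤ (2 * C + η) / η := by
      rw [le_div_iff₀ hη]; linarith
    calc _ ≤ _ := h8
      _ = _ := by field_simp; ring

theorem comparison {G V u w : ℝ → ℝ} {K p lam : ℝ} (hlam : 0 < lam)
    (hG : ∀ x y, |G x - G y| ≤ K * |x - y|) (hVc : Continuous V)
    (hu : Continuous u) (hw : Continuous w) (hub : ∃ C, ∀ y, |u y| ≤ C) (hwb : ∃ C, ∀ y, |w y| ≤ C)
    (hsub : IsViscositySubsolution (fun y r q => lam * r + G (p + q) + V y) u)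
    (hsup : IsViscositySupersolution (fun y r q => lam * r + G (p + q) + V y) w) (y : ℝ) :
    u y ≤ w y := by
  obtain ⟨C₁, hC₁⟩ := hub
  obtain ⟨C₂, hC₂⟩ := hwb
  have hK : 0 ≤ K := by
    have := (abs_nonneg _).trans (hG 1 0)
    simpa using this
  have key : ∀ η > 0, lam * (u y - w y) ≤ η * (K + 1 + lam * |y|) := by
    intro η hη
    obtain ⟨Φ, y₀, hΦ, hd, hmax, -, hΦy, -⟩ := exists_penalized_max (f := fun y => u y - w y)
      (hu.sub hw) (C := lam * (C₁ + C₂)) hlam hη (fun y => by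
        rw [abs_mul, abs_of_pos hlam]
        gcongr
        exact (abs_sub _ _).trans (add_le_add (hC₁ y) (hC₂ y)))
    have h1 := local_comparison hG hVc hu hw hΦ
      (Eventually.of_forall fun y φ hφ h => hsub φ hφ y h) hsup
      (Eventually.of_forall fun y => hmax y : IsLocalMax (fun x => u x - w x - Φ x) y₀)
    have h2 := mul_le_mul_of_nonneg_left (hmax y) hlam.le
    have h3 := mul_le_mul_of_nonneg_left (hd y₀) hK
    have h4 := hΦy y
    simp only [mul_sub] at *
    linarith
  have h0 : lam * (u y - w y) ≤ 0 := by
    have ht : Tendsto (fun η : ℝ => η * (K + 1 + lam * |y|)) (𝓝[>] 0)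
        (𝓝 (0 * (K + 1 + lam * |y|))) :=
      (tendsto_id.mul_const _).mono_left inf_le_left
    rw [zero_mul] at ht
    refine ge_of_tendsto ht ?_
    filter_upwards [self_mem_nhdsWithin] with η hη using key η hη
  nlinarith

theorem isViscositySubsolution_const {G V : ℝ → ℝ} {p lam c : ℝ}
    (h : ∀ y, lam * c + G p + V y ≤ 0) :
    IsViscositySubsolution (fun y r q => lam * r + G (p + q) + V y) (fun _ => c) := by
  intro φ hφ y hy
  have h1 : deriv φ y = 0 := by
    have := hy.deriv_eq_zero
    rwa [deriv_const_sub, neg_eq_zero] at this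
  simp only [h1, add_zero]
  exact h y

theorem isViscositySupersolution_const {G V : ℝ → ℝ} {p lam c : ℝ}
    (h : ∀ y, 0 ≤ lam * c + G p + V y) :
    IsViscositySupersolution (fun y r q => lam * r + G (p + q) + V y) (fun _ => c) := by
  intro φ hφ y hy
  have h1 : deriv φ y = 0 := by
    have := hy.deriv_eq_zero
    rwa [deriv_const_sub, neg_eq_zero] at this
  simp only [h1, add_zero]
  exact h y

theorem exists_abs_le_of_coercive {G : ℝ → ℝ} (hG : Coercive G) (p A : ℝ) :
    ∃ B, 0 ≤ B ∧ ∀ q, G (p + q) ≤ A → |q| ≤ B := by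
  have h := hG.eventually_gt_atTop A
  rw [Filter.Eventually, mem_cocompact] at h
  obtain ⟨t, ht, hts⟩ := h
  obtain ⟨R, hR⟩ := ht.isBounded.exists_norm_le
  refine ⟨max R 0 + |p|, by positivity, fun q hq => ?_⟩
  have h1 : p + q ∈ t := by
    by_contra hc
    exact absurd hq (not_le.2 (hts hc))
  have h2 := hR _ h1
  rw [Real.norm_eq_abs] at h2
  have h3 : |q| ≤ |p + q| + |p| := by
    have := abs_sub (p + q) p
    simpa using this
  linarith [le_max_left R 0]

/-! ### Perron's method -/

/-- Take members of the family within `e n` of the supremum at `y₀`. Subtracting `(t - y₀) ^ 2` from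
the difference with `φ` forces their maximum points to satisfy `(x n - y₀) ^ 2 ≤ e n`, so no
continuity of the supremum is needed. -/
theorem isViscositySubsolution_iSup {G V : ℝ → ℝ} {p lam : ℝ} (hlam : 0 < lam)
    (hG : Continuous G) (hVc : Continuous V) {S : Set (ℝ → ℝ)} (hne : S.Nonempty)
    (hc : ∀ w ∈ S, Continuous w) (hbdd : ∀ x, BddAbove (range fun w : S => w.1 x))
    (hsub : ∀ w ∈ S, IsViscositySubsolution (fun y r q => lam * r + G (p + q) + V y) w) :
    IsViscositySubsolution (fun y r q => lam * r + G (p + q) + V y) (fun x => ⨆ w : S, w.1 x) := by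
  intro φ hφ y₀ hmax
  set v : ℝ → ℝ := fun x => ⨆ w : S, w.1 x with hv
  have hle : ∀ w ∈ S, ∀ x, w x ≤ v x := fun w hw x => le_ciSup (hbdd x) ⟨w, hw⟩
  have : Nonempty S := hne.to_subtype
  obtain ⟨r, hr, hball⟩ := Metric.nhds_basis_closedBall.eventually_iff.1 hmax
  set e : ℕ → ℝ := fun n => 1 / ((n : ℝ) + 1) with he
  have he0 : ∀ n, 0 < e n := fun n => by simp only [he]; positivity
  have helim : Tendsto e atTop (𝓝 0) := tendsto_one_div_add_atTop_nhds_zero_nat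
  have hex : ∀ n, ∃ w ∈ S, ∃ x ∈ Metric.closedBall y₀ r, v y₀ - e n < w y₀ ∧
      ∀ t ∈ Metric.closedBall y₀ r, w t - φ t - (t - y₀) ^ 2 ≤ w x - φ x - (x - y₀) ^ 2 := by
    intro n
    obtain ⟨⟨w, hw⟩, hwn⟩ := exists_lt_of_lt_ciSup (sub_lt_self (v y₀) (he0 n))
    have hwc := hc w hw
    have hφc := hφ.continuous
    obtain ⟨x, hx, hxmax⟩ := (isCompact_closedBall y₀ r).exists_isMaxOn
      (f := fun t => w t - φ t - (t - y₀) ^ 2) ⟨y₀, Metric.mem_closedBall_self hr.le⟩ (by fun_prop)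
    exact ⟨w, hw, x, hx, hwn, hxmax⟩
  choose w hw x hxb hwe hxmax using hex
  have hkey : ∀ n, (x n - y₀) ^ 2 ≤ e n ∧ v y₀ - e n + φ (x n) - φ y₀ ≤ w n (x n) := by
    intro n
    have h1 := hxmax n y₀ (Metric.mem_closedBall_self hr.le)
    have h2 := hle _ (hw n) (x n)
    have h3 : v (x n) - φ (x n) ≤ v y₀ - φ y₀ := hball (hxb n)
    have h4 := hwe n
    simp only [sub_self, ne_eq, OfNat.ofNat_ne_zero, not_false_eq_true, zero_pow, sub_zero] at h1
    exact ⟨by linarith, by nlinarith [sq_nonneg (x n - y₀)]⟩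
  have hxl : Tendsto x atTop (𝓝 y₀) := by
    have h1 : Tendsto (fun n => (x n - y₀) ^ 2) atTop (𝓝 0) :=
      squeeze_zero (fun n => sq_nonneg _) (fun n => (hkey n).1) helim
    have h2 := (Real.continuous_sqrt.tendsto 0).comp h1
    rw [Real.sqrt_zero] at h2
    rw [tendsto_iff_dist_tendsto_zero]
    refine h2.congr fun n => ?_
    simp [Real.sqrt_sq_eq_abs, Real.dist_eq]
  have hineq : ∀ᶠ n in atTop, lam * (v y₀ - e n + φ (x n) - φ y₀) +
      G (p + (deriv φ (x n) + 2 * (x n - y₀))) + V (x n) ≤ 0 := by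
    filter_upwards [hxl.eventually (eventually_mem_nhds_iff.2 (Metric.closedBall_mem_nhds y₀ hr))]
      with n hn
    have h1 := hsub _ (hw n) (fun t => φ t + (t - y₀) ^ 2) (by fun_prop) (x n) (by
      filter_upwards [hn] with t ht
      have := hxmax n t ht
      linarith)
    have hsq : HasDerivAt (fun s : ℝ => (s - y₀) ^ 2) (2 * (x n - y₀)) (x n) := by
      simpa using ((hasDerivAt_id (x n)).sub_const y₀).fun_pow 2
    have d1 : deriv (fun t => φ t + (t - y₀) ^ 2) (x n) = deriv φ (x n) + 2 * (x n - y₀) :=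
      (((hφ.differentiable one_ne_zero) (x n)).hasDerivAt.add hsq).deriv
    simp only [d1] at h1
    have h2 := mul_le_mul_of_nonneg_left (hkey n).2 hlam.le
    linarith
  have hdc : Continuous (deriv φ) := hφ.continuous_deriv le_rfl
  have hlim : Tendsto (fun n => lam * (v y₀ - e n + φ (x n) - φ y₀) +
      G (p + (deriv φ (x n) + 2 * (x n - y₀))) + V (x n)) atTop
      (𝓝 (lam * (v y₀ - 0 + φ y₀ - φ y₀) + G (p + (deriv φ y₀ + 2 * (y₀ - y₀))) + V y₀)) :=
    ((((((helim.const_sub (v y₀)).add ((hφ.continuous.tendsto _).comp hxl)).sub_const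
      (φ y₀)).const_mul lam).add ((hG.tendsto _).comp ((((hdc.tendsto _).comp hxl).add
        ((hxl.sub_const y₀).const_mul 2)).const_add p))).add ((hVc.tendsto _).comp hxl))
  have := le_of_tendsto hlim hineq
  simpa using this

/-- If a continuous subsolution is not a supersolution, it can be increased near a point. -/
theorem exists_bump {G V v : ℝ → ℝ} {p lam : ℝ} (hlam : 0 < lam)
    (hG : Continuous G) (hVc : Continuous V) (hv : Continuous v)
    (hvb : ∃ C, ∀ y, |v y| ≤ C)
    (hsub : IsViscositySubsolution (fun y r q => lam * r + G (p + q) + V y) v)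
    (hnot : ¬ IsViscositySupersolution (fun y r q => lam * r + G (p + q) + V y) v) :
    ∃ w : ℝ → ℝ, Continuous w ∧ (∃ C, ∀ y, |w y| ≤ C) ∧ (∀ y, v y ≤ w y) ∧ (∃ y, v y < w y) ∧
      IsViscositySubsolution (fun y r q => lam * r + G (p + q) + V y) w := by
  simp only [IsViscositySupersolution, not_forall, not_le] at hnot
  obtain ⟨φ, hφ, y₀, hmin, hneg⟩ := hnot
  -- Bending the test function down makes the contact strict, so that a slightly raised `ψ` exceeds
  -- `v` only well inside the ball.
  set ψ : ℝ → ℝ := fun x => φ x - φ y₀ + v y₀ - (x - y₀) ^ 2 with hψ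
  have hψc : ContDiff ℝ 1 ψ := by simp only [hψ]; fun_prop
  have hdc : Continuous (deriv ψ) := hψc.continuous_deriv le_rfl
  have hd0 : deriv ψ y₀ = deriv φ y₀ := by
    have hsq : HasDerivAt (fun s : ℝ => (s - y₀) ^ 2) (2 * (y₀ - y₀)) y₀ := by
      simpa using ((hasDerivAt_id y₀).sub_const y₀).fun_pow 2
    have : HasDerivAt ψ _ y₀ := ((((hφ.differentiable one_ne_zero) y₀).hasDerivAt.sub_const
      (φ y₀)).add_const (v y₀)).sub hsq
    simpa using this.deriv
  have hψ0 : ψ y₀ = v y₀ := by simp [hψ]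
  set Q : ℝ → ℝ := fun x => lam * ψ x + G (p + deriv ψ x) + V x with hQ
  have hQc : Continuous Q := by
    have := hψc.continuous
    simp only [hQ]; fun_prop
  set m := -Q y₀ / 2 with hm
  have hm0 : 0 < m := by
    simp only [hm, hQ, hψ0, hd0]; linarith
  have hQm : ∀ᶠ x in 𝓝 y₀, Q x < -m :=
    (hQc.tendsto y₀).eventually_lt_const (by simp only [hm] at *; linarith)
  obtain ⟨r, hr, hball⟩ := Metric.nhds_basis_closedBall.eventually_iff.1 (hQm.and hmin)
  -- The first bound keeps `ψ + e` a subsolution in the ball; the second makes the bump end before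
  -- the boundary.
  set e := min (m / lam) (r ^ 2 / 2) with he
  have he0 : 0 < e := by positivity
  have hem : lam * e ≤ m := by
    have := mul_le_mul_of_nonneg_left (min_le_left (m / lam) (r ^ 2 / 2)) hlam.le
    rwa [mul_div_cancel₀ _ hlam.ne'] at this
  have her : e < r ^ 2 := by
    have : e ≤ r ^ 2 / 2 := min_le_right _ _
    have : 0 < r ^ 2 := by positivity
    linarith
  have hmem : ∀ x, |x - y₀| ≤ r → x ∈ Metric.closedBall y₀ r := fun x hx => by
    rwa [Metric.mem_closedBall, Real.dist_eq]
  have hlow : ∀ x, |x - y₀| ≤ r → ψ x + (x - y₀) ^ 2 ≤ v x := fun x hx => by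
    have := (hball (hmem x hx)).2
    simp only [hψ]; linarith
  have hin : ∀ x, |x - y₀| ≤ r → v x < ψ x + e → |x - y₀| < r := fun x hx h => by
    have h1 := hlow x hx
    exact abs_lt_of_sq_lt_sq (by linarith) hr.le
  set w : ℝ → ℝ := fun x => if |x - y₀| ≤ r then max (v x) (ψ x + e) else v x with hw
  have hwge : ∀ x, v x ≤ w x := fun x => by
    simp only [hw]; split_ifs
    · exact le_max_left _ _
    · exact le_rfl
  have hwψ : ∀ x, |x - y₀| ≤ r → ψ x + e ≤ w x := fun x hx => by
    simp only [hw, if_pos hx]; exact le_max_right _ _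
  have hwcase : ∀ x, w x = v x ∨ (|x - y₀| < r ∧ w x = ψ x + e) := by
    intro x
    by_cases hx : |x - y₀| ≤ r
    · rcases le_or_gt (ψ x + e) (v x) with h | h
      · left; simp only [hw, if_pos hx, max_eq_left h]
      · right; exact ⟨hin x hx h, by simp only [hw, if_pos hx, max_eq_right h.le]⟩
    · left; simp only [hw, if_neg hx]
  have hψcont := hψc.continuous
  refine ⟨w, ?_, ?_, hwge, ⟨y₀, ?_⟩, ?_⟩
  · rw [continuous_iff_continuousAt]
    intro x
    rcases lt_or_ge |x - y₀| r with hx | hx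
    · have h1 : ∀ᶠ t in 𝓝 x, |t - y₀| < r :=
        ((by fun_prop : Continuous fun t : ℝ => |t - y₀|).tendsto x).eventually_lt_const hx
      have h2 : Continuous fun t => max (v t) (ψ t + e) := by fun_prop
      refine h2.continuousAt.congr ?_
      filter_upwards [h1] with t ht
      simp only [hw, if_pos ht.le]
    · have h1 : ∀ᶠ t in 𝓝 x, e < (t - y₀) ^ 2 := by
        refine ((by fun_prop : Continuous fun t : ℝ => (t - y₀) ^ 2).tendsto x).eventually_const_lt ?_
        rw [← sq_abs]; nlinarith
      refine hv.continuousAt.congr ?_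
      filter_upwards [h1] with t ht
      simp only [hw]
      split_ifs with h
      · rw [max_eq_left]
        linarith [hlow t h]
      · rfl
  · obtain ⟨C, hC⟩ := hvb
    obtain ⟨B, hB⟩ := (isCompact_closedBall y₀ r).exists_bound_of_continuousOn
      (f := fun x => ψ x + e) (by fun_prop)
    refine ⟨max C B, fun y => ?_⟩
    rcases hwcase y with h | ⟨h, h'⟩
    · rw [h]; exact (hC y).trans (le_max_left _ _)
    · rw [h']; exact (hB y (hmem y h.le)).trans (le_max_right _ _)
  · have := hwψ y₀ (by simpa using hr.le)
    linarith
  · intro χ hχ y hy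
    rcases hwcase y with h | ⟨h, h'⟩
    · have := hsub χ hχ y (by
        filter_upwards [hy] with t ht
        rw [h] at ht
        linarith [hwge t])
      simpa only [h] using this
    · have h1 : ∀ᶠ t in 𝓝 y, |t - y₀| < r :=
        ((by fun_prop : Continuous fun t : ℝ => |t - y₀|).tendsto y).eventually_lt_const h
      have h2 : IsLocalMax (fun t => ψ t - χ t) y := by
        filter_upwards [hy, h1] with t ht ht'
        rw [h'] at ht
        linarith [hwψ t ht'.le]
      have h3 := h2.deriv_eq_zero
      have h4 : deriv (fun t => ψ t - χ t) y = deriv ψ y - deriv χ y :=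
        (((hψc.differentiable one_ne_zero) y).hasDerivAt.sub
          ((hχ.differentiable one_ne_zero) y).hasDerivAt).deriv
      have h5 : deriv χ y = deriv ψ y := by linarith
      have h6 := (hball (hmem y h.le)).1
      simp only [h5, h', hQ] at *
      linarith

theorem real_lipschitz {H : ℝ → ℝ} (h : ∃ K, LipschitzWith K H) :
    ∃ K : ℝ, 0 < K ∧ ∀ x y, |H x - H y| ≤ K * |x - y| := by
  obtain ⟨K, hK⟩ := h
  refine ⟨K + 1, by positivity, fun x y => ?_⟩
  have := hK.dist_le_mul x y
  rw [Real.dist_eq, Real.dist_eq] at this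
  nlinarith [abs_nonneg (x - y)]

/-- Uniqueness is comparison. For existence, the constants `-C` and `C` are a sub- and a
supersolution, and coercivity makes the subsolutions between them equi-Lipschitz. Their supremum is
thus a continuous subsolution; were it not a supersolution, a bump would produce a larger member of
the family. -/
theorem existsUnique_isCellSolution {H : ℝ → ℝ} (hlip : ∃ K, LipschitzWith K H)
    (hcoer : Coercive H) (V : BUC) (p : ℝ) {lam : ℝ} (hlam : 0 < lam) :
    ∃! v : ℝ → ℝ, IsCellSolution H V p lam v := by
  obtain ⟨⟨CV, hCV⟩, hVu⟩ := V.2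
  have hVc : Continuous V.1 := hVu.continuous
  have hHc : Continuous H := hlip.choose_spec.continuous
  obtain ⟨K, -, hK⟩ := real_lipschitz hlip
  refine existsUnique_of_exists_of_unique ?_ fun v w hv hw => funext fun y => le_antisymm
    (comparison hlam hK hVc hv.continuous hw.continuous hv.bounded hw.bounded hv.sub hw.super y)
    (comparison hlam hK hVc hw.continuous hv.continuous hw.bounded hv.bounded hw.sub hv.super y)
  set C := (|H p| + CV) / lam with hC
  have hlC : lam * C = |H p| + CV := by rw [hC]; field_simp
  have hCV0 : 0 ≤ CV := (abs_nonneg _).trans (hCV 0)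
  have hC0 : 0 ≤ C := by positivity
  set S : Set (ℝ → ℝ) := {w | Continuous w ∧
    IsViscositySubsolution (fun y r q => lam * r + H (p + q) + V y) w ∧ ∀ y, |w y| ≤ C} with hS
  have hne : S.Nonempty := ⟨fun _ => -C, continuous_const,
    isViscositySubsolution_const fun y => by
      have := le_abs_self (H p); have := (abs_le.1 (hCV y)).2; linarith,
    fun y => by rw [abs_neg, abs_of_nonneg hC0]⟩
  have hneS : Nonempty S := hne.to_subtype
  obtain ⟨B, hB0, hB⟩ := exists_abs_le_of_coercive hcoer p (lam * C + CV)
  have hSlip : ∀ w ∈ S, ∀ x y, |w x - w y| ≤ B * |x - y| := fun w hw =>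
    abs_sub_le_of_test_le hw.1 fun φ hφ y hy => hB _ (by
      have h1 := hw.2.1 φ hφ y hy
      have h2 := mul_le_mul_of_nonneg_left (abs_le.1 (hw.2.2 y)).1 hlam.le
      have h3 := (abs_le.1 (hCV y)).1
      simp only at h1
      linarith)
  have hbdd : ∀ x, BddAbove (range fun w : S => w.1 x) := fun x =>
    ⟨C, by rintro _ ⟨w, rfl⟩; exact (abs_le.1 (w.2.2.2 x)).2⟩
  set v : ℝ → ℝ := fun x => ⨆ w : S, w.1 x with hv
  have hle : ∀ w ∈ S, ∀ x, w x ≤ v x := fun w hw x => le_ciSup (hbdd x) ⟨w, hw⟩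
  have hvb : ∀ y, |v y| ≤ C := fun y => abs_le.2
    ⟨(abs_le.1 (hne.some_mem.2.2 y)).1.trans (hle _ hne.some_mem y),
      ciSup_le fun w => (abs_le.1 (w.2.2.2 y)).2⟩
  have hvlip : ∀ x y, v x ≤ v y + B * |x - y| := fun x y => ciSup_le fun w => by
    have h1 := (abs_le.1 (hSlip w w.2 x y)).2
    have h2 := hle w w.2 y
    linarith
  have hvc : Continuous v := by
    refine LipschitzWith.continuous (K := B.toNNReal) (LipschitzWith.of_dist_le_mul fun x y => ?_)
    rw [Real.dist_eq, Real.dist_eq, Real.coe_toNNReal _ hB0, abs_le]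
    have h1 := hvlip x y
    have h2 := hvlip y x
    rw [abs_sub_comm y x] at h2
    exact ⟨by linarith, by linarith⟩
  have hvsub := isViscositySubsolution_iSup (p := p) hlam hHc hVc hne (fun w hw => hw.1) hbdd
    (fun w hw => hw.2.1)
  refine ⟨v, hvc, ⟨C, hvb⟩, hvsub, ?_⟩
  by_contra hnot
  obtain ⟨w, hwc, hwb, hvw, ⟨y, hy⟩, hwsub⟩ := exists_bump hlam hHc hVc hvc ⟨C, hvb⟩ hvsub hnot
  have hwC : ∀ y, w y ≤ C := comparison (w := fun _ => C) hlam hK hVc hwc continuous_const hwb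
    ⟨C, fun y => by rw [abs_of_nonneg hC0]⟩ hwsub (isViscositySupersolution_const fun y => by
      have := neg_abs_le (H p); have := (abs_le.1 (hCV y)).1; linarith)
  exact absurd (hle w ⟨hwc, hwsub, fun y => abs_le.2
    ⟨(abs_le.1 (hvb y)).1.trans (hvw y), hwC y⟩⟩ y) (not_le.2 hy)

/-! ### Elementary estimates for the cell problem -/

theorem BUC.continuous (V : BUC) : Continuous V.1 := V.2.2.continuous

/-- On the scale `1 / lam`, the upper limit of `lam * v lam` is at most `c`. -/
def ScaledLimsupLE (v : ℝ → ℝ → ℝ) (c : ℝ) : Prop :=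
  ∀ R > 0, ∀ ε > 0, ∀ᶠ lam in 𝓝[>] (0 : ℝ), ∀ y, lam * |y| ≤ R → lam * v lam y ≤ c + ε

/-- On the scale `1 / lam`, the lower limit of `lam * v lam` is at least `c`. -/
def ScaledLiminfGE (v : ℝ → ℝ → ℝ) (c : ℝ) : Prop :=
  ∀ R > 0, ∀ ε > 0, ∀ᶠ lam in 𝓝[>] (0 : ℝ), ∀ y, lam * |y| ≤ R → c - ε ≤ lam * v lam y

theorem ScaledLimsupLE.mono {v w : ℝ → ℝ → ℝ} {c d : ℝ} (h : ScaledLimsupLE v c)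
    (hw : ∀ lam > 0, ∀ y, w lam y ≤ v lam y) (hcd : c ≤ d) : ScaledLimsupLE w d := by
  intro R hR ε hε
  filter_upwards [h R hR ε hε, self_mem_nhdsWithin] with lam hlam hpos y hy
  have := mul_le_mul_of_nonneg_left (hw lam hpos y) (le_of_lt hpos)
  linarith [hlam y hy]

theorem ScaledLiminfGE.mono {v w : ℝ → ℝ → ℝ} {c d : ℝ} (h : ScaledLiminfGE v c)
    (hw : ∀ lam > 0, ∀ y, v lam y ≤ w lam y) (hcd : d ≤ c) : ScaledLiminfGE w d := by
  intro R hR ε hε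
  filter_upwards [h R hR ε hε, self_mem_nhdsWithin] with lam hlam hpos y hy
  have := mul_le_mul_of_nonneg_left (hw lam hpos y) (le_of_lt hpos)
  linarith [hlam y hy]

theorem ScaledLimsupLE.of_forall {v : ℝ → ℝ → ℝ} {c : ℝ}
    (h : ∀ lam > 0, ∀ y, lam * v lam y ≤ c) : ScaledLimsupLE v c := by
  intro R hR ε hε
  filter_upwards [self_mem_nhdsWithin] with lam hpos y _
  linarith [h lam hpos y]

theorem ScaledLimsupLE.comp_neg {v : ℝ → ℝ → ℝ} {c : ℝ} (h : ScaledLimsupLE v c) :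
    ScaledLimsupLE (fun lam y => v lam (-y)) c := by
  intro R hR ε hε
  filter_upwards [h R hR ε hε] with lam hlam y hy
  exact hlam (-y) (by rwa [abs_neg])

theorem ScaledLiminfGE.comp_neg {v : ℝ → ℝ → ℝ} {c : ℝ} (h : ScaledLiminfGE v c) :
    ScaledLiminfGE (fun lam y => v lam (-y)) c := by
  intro R hR ε hε
  filter_upwards [h R hR ε hε] with lam hlam y hy
  exact hlam (-y) (by rwa [abs_neg])

/-- The limits of a family are ordered. -/
theorem ScaledLiminfGE.le {v : ℝ → ℝ → ℝ} {c d : ℝ} (h : ScaledLiminfGE v c)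
    (h' : ScaledLimsupLE v d) : c ≤ d := by
  refine le_of_forall_pos_le_add fun ε hε => ?_
  obtain ⟨lam, h1, h2⟩ := ((h 1 one_pos (ε / 2) (by positivity)).and
    (h' 1 one_pos (ε / 2) (by positivity))).exists
  have := h1 0 (by simp)
  have := h2 0 (by simp)
  linarith

theorem IsCellSolution.le_of_le {H G : ℝ → ℝ} {V : BUC} {p lam K : ℝ} {v w : ℝ → ℝ}
    (hlam : 0 < lam) (hK : ∀ x y, |H x - H y| ≤ K * |x - y|) (hHG : ∀ q, H q ≤ G q)
    (hv : IsCellSolution H V p lam v) (hw : IsCellSolution G V p lam w) (y : ℝ) : w y ≤ v y :=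
  comparison hlam hK V.continuous hw.continuous hv.continuous hw.bounded hv.bounded
    (fun φ hφ y hy => by
      have := hw.sub φ hφ y hy
      have := hHG (p + deriv φ y)
      simp only at *
      linarith) hv.super y

theorem IsCellSolution.neg_le {H : ℝ → ℝ} {V : BUC} {p lam K : ℝ} {v : ℝ → ℝ}
    (hlam : 0 < lam) (hK : ∀ x y, |H x - H y| ≤ K * |x - y|) (hV : ∀ y, V y ≤ 0)
    (hv : IsCellSolution H V p lam v) (y : ℝ) : -H p ≤ lam * v y := by
  have h := comparison (u := fun _ => -H p / lam) hlam hK V.continuous continuous_const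
    hv.continuous ⟨_, fun _ => le_rfl⟩ hv.bounded (isViscositySubsolution_const fun y => by
      rw [mul_div_cancel₀ _ hlam.ne']; linarith [hV y]) hv.super y
  rwa [div_le_iff₀' hlam] at h

theorem IsCellSolution.le_neg {H : ℝ → ℝ} {V : BUC} {p lam K mbar : ℝ} {v : ℝ → ℝ}
    (hlam : 0 < lam) (hK : ∀ x y, |H x - H y| ≤ K * |x - y|) (hV : ∀ y, -mbar ≤ V y)
    (hv : IsCellSolution H V p lam v) (y : ℝ) : lam * v y ≤ -(H p - mbar) := by
  have h := comparison (w := fun _ => -(H p - mbar) / lam) hlam hK V.continuous hv.continuous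
    continuous_const hv.bounded ⟨_, fun _ => le_rfl⟩ hv.sub
    (isViscositySupersolution_const fun y => by
      rw [mul_div_cancel₀ _ hlam.ne']; linarith [hV y]) y
  rwa [le_div_iff₀' hlam] at h

theorem IsCellSolution.abs_le {H : ℝ → ℝ} {V : BUC} {p lam K mbar : ℝ} {v : ℝ → ℝ}
    (hlam : 0 < lam) (hK : ∀ x y, |H x - H y| ≤ K * |x - y|) (hV : ∀ y, V y ∈ Icc (-mbar) 0)
    (hv : IsCellSolution H V p lam v) (y : ℝ) : |lam * v y| ≤ |H p| + mbar := by
  have h1 := hv.neg_le hlam hK (fun y => (hV y).2) y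
  have h2 := hv.le_neg hlam hK (fun y => (hV y).1) y
  have h3 := le_abs_self (H p)
  have h4 := neg_abs_le (H p)
  have h5 := (hV 0).1.trans (hV 0).2
  exact _root_.abs_le.2 ⟨by linarith, by linarith⟩

/-- The constant does not depend on `lam`, because `lam * v` is bounded uniformly in `lam` and the
subsolution inequality then bounds `H (p + φ')`. -/
theorem exists_lipschitz_cellSolution {H : ℝ → ℝ} {V : BUC} {p K mbar : ℝ}
    (hK : ∀ x y, |H x - H y| ≤ K * |x - y|) (hcoer : Coercive H)
    (hV : ∀ y, V y ∈ Icc (-mbar) 0) :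
    ∃ B > 0, ∀ lam > 0, ∀ v, IsCellSolution H V p lam v → ∀ x y, |v x - v y| ≤ B * |x - y| := by
  obtain ⟨B, hB0, hB⟩ := exists_abs_le_of_coercive hcoer p (|H p| + mbar + mbar)
  refine ⟨B + 1, by positivity, fun lam hlam v hv => abs_sub_le_of_test_le hv.continuous
    fun φ hφ y hy => (hB _ ?_).trans (by linarith)⟩
  have h1 := hv.sub φ hφ y hy
  have h2 := (_root_.abs_le.1 (hv.abs_le hlam hK hV y)).1
  have h3 := (hV y).1
  simp only at h1
  linarith

/-- The reflected potential. -/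
def reflect (V : BUC) : BUC :=
  ⟨fun x => V (-x), by
    obtain ⟨⟨C, hC⟩, hV⟩ := V.2
    exact ⟨⟨C, fun x => hC (-x)⟩, hV.comp uniformContinuous_id.neg⟩⟩

/-- This symmetry exchanges the two sides of the barrier, so each upper bound is proved on the left
only. -/
theorem IsCellSolution.reflect {H : ℝ → ℝ} {V : BUC} {p lam : ℝ} {v : ℝ → ℝ}
    (hv : IsCellSolution H V p lam v) :
    IsCellSolution (fun q => H (-q)) (reflect V) (-p) lam (fun x => v (-x)) where
  continuous := hv.continuous.comp continuous_neg
  bounded := hv.bounded.imp fun C hC y => hC (-y)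
  sub φ hφ y hy := by
    have h := hv.sub (fun x => φ (-x)) (hφ.comp contDiff_neg) (-y)
      (by simpa using isLocalMax_comp_neg hy)
    rw [deriv_comp_neg, neg_neg] at h
    have e : -(-p + deriv φ y) = p + -deriv φ y := by ring
    simp only [e]
    exact h
  super φ hφ y hy := by
    have h := hv.super (fun x => φ (-x)) (hφ.comp contDiff_neg) (-y)
      (by simpa using isLocalMin_comp_neg hy)
    rw [deriv_comp_neg, neg_neg] at h
    have e : -(-p + deriv φ y) = p + -deriv φ y := by ring
    simp only [e]
    exact h

theorem deriv_le_of_antitoneOn {v φ : ℝ → ℝ} {y s t q : ℝ} (hφ : ContDiff ℝ 1 φ)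
    (hy : y ∈ Ioo s t) (hanti : AntitoneOn (fun x => v x - q * x) (Icc s t))
    (hmax : IsLocalMax (fun x => v x - φ x) y) : deriv φ y ≤ q := by
  have hd := ((hφ.differentiable one_ne_zero) y).hasDerivAt.tendsto_slope
  have hd' : Tendsto (slope φ y) (𝓝[<] y) (𝓝 (deriv φ y)) :=
    hd.mono_left (nhdsWithin_mono _ fun x hx => ne_of_lt hx)
  refine le_of_tendsto hd' ?_
  filter_upwards [Ioo_mem_nhdsLT hy.1, mem_nhdsWithin_of_mem_nhds hmax] with x hx hm
  have h1 := hanti ⟨hx.1.le, hx.2.le.trans hy.2.le⟩ ⟨hy.1.le, hy.2.le⟩ hx.2.le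
  simp only at hm h1
  rw [slope_def_field, div_le_iff_of_neg (by linarith [hx.2])]
  linarith

/-- Near `y₀` every test function from above has total gradient at most `b`, where `H = G`; so `v`
is locally a subsolution of the equation of `G`. -/
theorem local_comparison_of_antitoneOn {H G : ℝ → ℝ} {V : BUC} {p lam K b : ℝ} {v w Φ : ℝ → ℝ}
    (hK : ∀ x y, |G x - G y| ≤ K * |x - y|) (hHG : ∀ q ≤ b, H q = G q)
    (hv : IsCellSolution H V p lam v) (hw : IsCellSolution G V p lam w) (hΦ : ContDiff ℝ 1 Φ)
    {y₀ s t : ℝ} (hy₀ : y₀ ∈ Ioo s t)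
    (hanti : AntitoneOn (fun x => v x - (b - p) * x) (Icc s t))
    (hmax : ∀ y, v y - w y - Φ y ≤ v y₀ - w y₀ - Φ y₀) :
    lam * (v y₀ - w y₀) ≤ K * |deriv Φ y₀| := by
  refine local_comparison hK V.continuous hv.continuous hw.continuous hΦ ?_ hw.super
    (Eventually.of_forall hmax)
  filter_upwards [Ioo_mem_nhds hy₀.1 hy₀.2] with y hy φ hφ h
  have h1 := deriv_le_of_antitoneOn hφ hy hanti h
  rw [← hHG _ (by linarith)]
  exact hv.sub φ hφ y h

/-! ### Upper bounds for the solutions -/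

/-- Gluing at a barrier: to the left of `b` the two Hamiltonians agree. -/
theorem scaledLimsupLE_of_lt_barrier {H G : ℝ → ℝ} {V : BUC} {p b c mbar K K' : ℝ}
    {v w : ℝ → ℝ → ℝ} (hV : ∀ y, V y ∈ Icc (-mbar) 0)
    (hK : ∀ x y, |G x - G y| ≤ K * |x - y|) (hK' : ∀ x y, |H x - H y| ≤ K' * |x - y|)
    (hcoer : Coercive H) (hHG : ∀ q ≤ b, H q = G q) (hp : p < b)
    (hv : ∀ lam > 0, IsCellSolution H V p lam (v lam))
    (hw : ∀ lam > 0, IsCellSolution G V p lam (w lam))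
    (hw1 : ScaledLimsupLE w (-c)) (hw2 : ScaledLiminfGE w (-c)) :
    ScaledLimsupLE v (max (-c) (-(H b - mbar))) := by
  intro R hR ε hε
  have hK0 : 0 ≤ K := by
    have := (abs_nonneg _).trans (hK 1 0)
    simpa using this
  have hmbar : 0 ≤ mbar := by linarith [(hV 0).1.trans (hV 0).2]
  obtain ⟨B, hB0, hB⟩ := exists_lipschitz_cellSolution (p := p) hK' hcoer hV
  set σ := b - p with hσ
  have hσ0 : 0 < σ := by linarith
  -- The penalization must cost less than half of the slope `σ`; its total effect, `K * η` in the
  -- comparison and `η * (1 + R)` in moving from `y₀` to `y`, must be at most `ε / 4`.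
  set η := min (σ / 2) (ε / (4 * (K + 1 + R))) with hη
  have hη0 : 0 < η := by positivity
  have hησ : η ≤ σ / 2 := min_le_left _ _
  have hηε : η * (K + 1 + R) ≤ ε / 4 := by
    have : η ≤ ε / (4 * (K + 1 + R)) := min_le_right _ _
    rw [le_div_iff₀ (by positivity)] at this
    linarith
  -- On a window of half-width `d / lam` the function `lam * v lam` varies by at most `ε / 8`.
  set d := ε / (8 * B) with hd
  have hd0 : 0 < d := by positivity
  have hBd : B * d = ε / 8 := by rw [hd]; field_simp
  -- The oscillation `2 * δ` of `lam * w lam` must be small against the climb `σ * d` of a function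
  -- of slope `σ` over the window.
  set δ := min (ε / 8) (σ * d / 8) with hδ
  have hδ0 : 0 < δ := by positivity
  have hδε : δ ≤ ε / 8 := min_le_left _ _
  have hδσ : δ ≤ σ * d / 8 := min_le_right _ _
  set C := |H p| + mbar + (|G p| + mbar) with hC
  have hC0 : 0 ≤ C := by positivity
  set R₂ := 1 + 2 * C / η + d + R with hR₂
  have hR₂0 : 0 < R₂ := by positivity
  filter_upwards [hw1 R₂ hR₂0 δ hδ0, hw2 R₂ hR₂0 δ hδ0, self_mem_nhdsWithin]
    with lam hup hlow hlam y hy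
  have hlam : 0 < lam := hlam
  obtain ⟨Φ, y₀, hΦ, hΦd, hmax, hΦ1, hΦ2, hy₀⟩ :=
    exists_penalized_max (f := fun y => v lam y - w lam y) (C := C) (lam := lam) (η := η)
    ((hv lam hlam).continuous.sub (hw lam hlam).continuous) hlam hη0 (fun y => by
      rw [mul_sub]
      exact (abs_sub _ _).trans (add_le_add ((hv lam hlam).abs_le hlam hK' hV y)
        ((hw lam hlam).abs_le hlam hK hV y)))
  have hyR : lam * |y| ≤ R₂ := hy.trans (by simp only [hR₂]; have : 0 ≤ C / η := by positivity
                                            linarith [mul_div_assoc 2 C η])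
  have hy₀R : lam * |y₀| ≤ R₂ := by simp only [hR₂]; linarith
  -- the bound at the point of maximum is transported to `y`
  have htrans : lam * v lam y ≤ lam * w lam y + lam * (v lam y₀ - w lam y₀) + η * (1 + R) := by
    have h1 := mul_le_mul_of_nonneg_left (hmax y) hlam.le
    have h2 := hΦ2 y
    have h3 : η * (1 + lam * |y|) ≤ η * (1 + R) := by gcongr
    simp only [mul_sub] at *
    linarith
  have hKη : 0 ≤ K * η := by positivity
  -- In the first case the bound at `y₀` carries over to `y`, since `lam * w lam` is nearly
  -- constant. In the second, `lam * v lam` stays above the barrier level in the whole window.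
  rcases le_or_gt (lam * v lam y₀) (-(H b - mbar) + ε / 4) with hcase | hcase
  · have h1 := hup y hyR
    have h2 := hlow y₀ hy₀R
    have h3 := le_max_right (-c) (-(H b - mbar))
    simp only [mul_sub] at *
    linarith
  · set D := d / lam with hD
    have hD0 : 0 < D := by positivity
    have hlD : lam * D = d := by rw [hD]; field_simp
    have hnomax : ∀ x ∈ Ioo (y₀ - D) (y₀ + D),
        ¬ IsLocalMax (fun x => v lam x - (b - p) * x) x := by
      intro x hx hm
      have h1 := (hv lam hlam).sub (fun x => (b - p) * x) (by fun_prop) x hm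
      have h2 : deriv (fun x : ℝ => (b - p) * x) x = b - p := by
        simp
      simp only [h2, add_sub_cancel] at h1
      have h3 := (abs_le.1 (hB lam hlam _ (hv lam hlam) x y₀)).1
      have h4 : |x - y₀| ≤ D := abs_le.2 ⟨by linarith [hx.1], by linarith [hx.2]⟩
      have h5 : lam * (B * |x - y₀|) ≤ ε / 8 := by
        calc lam * (B * |x - y₀|) ≤ lam * (B * D) := by gcongr
          _ = B * (lam * D) := by ring
          _ = ε / 8 := by rw [hlD, hBd]
      have h6 := mul_le_mul_of_nonneg_left h3 hlam.le
      have h7 := (hV x).1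
      simp only [mul_sub, mul_neg] at h6
      linarith
    have hvc := (hv lam hlam).continuous
    obtain ⟨z, hz, hanti, hmono⟩ := exists_antitoneOn_monotoneOn (by linarith)
      (by fun_prop : ContinuousOn (fun x => v lam x - (b - p) * x) (Icc (y₀ - D) (y₀ + D))) hnomax
    -- If `y₀` were on the increasing branch, `v` would climb with slope at least `σ` up to the end
    -- of the window, against the maximality of `v - w - Φ` at `y₀`.
    have hzy : y₀ < z := by
      by_contra! hzy
      have h1 := hmono ⟨hzy, by linarith⟩ ⟨hz.2, le_rfl⟩ (by linarith : y₀ ≤ y₀ + D)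
      simp only at h1
      have h2 := hmax (y₀ + D)
      have h3 := hΦ1 (y₀ + D)
      rw [add_sub_cancel_left, abs_of_pos hD0] at h3
      have h4 : lam * |y₀ + D| ≤ R₂ := by
        calc lam * |y₀ + D| ≤ lam * (|y₀| + |D|) := by gcongr; exact abs_add_le _ _
          _ = lam * |y₀| + d := by rw [abs_of_pos hD0, mul_add, hlD]
          _ ≤ R₂ := by simp only [hR₂]; linarith
      have h5 := hup _ h4
      have h6 := hlow _ hy₀R
      have h7 : σ * D ≤ w lam (y₀ + D) - w lam y₀ + η * D := by linarith
      have h8 := mul_le_mul_of_nonneg_left h7 hlam.le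
      have h9 : σ * d ≤ 2 * δ + η * d := by
        calc σ * d = lam * (σ * D) := by rw [← hlD]; ring
          _ ≤ _ := h8
          _ = lam * w lam (y₀ + D) - lam * w lam y₀ + η * (lam * D) := by ring
          _ ≤ _ := by rw [hlD]; linarith
      have h10 : η * d ≤ σ / 2 * d := by gcongr
      have h11 : 0 < σ * d := by positivity
      linarith
    have h1 := local_comparison_of_antitoneOn hK hHG (hv lam hlam) (hw lam hlam) hΦ
      (s := y₀ - D) (t := z) ⟨by linarith, hzy⟩ hanti hmax
    have h2 := mul_le_mul_of_nonneg_left (hΦd y₀) hK0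
    have h3 := hup y hyR
    have h4 := le_max_left (-c) (-(H b - mbar))
    linarith

/-- To the left of the well at `a`, a solution below the bottom of the well has gradient at
most `a`. -/
theorem scaledLimsupLE_of_lt_well {H G : ℝ → ℝ} {V : BUC} {p a b c e mbar K K' : ℝ}
    {v w : ℝ → ℝ → ℝ} (hV : ∀ y, V y ∈ Icc (-mbar) 0)
    (hK : ∀ x y, |G x - G y| ≤ K * |x - y|) (hK' : ∀ x y, |H x - H y| ≤ K' * |x - y|)
    (hHG : ∀ q ≤ b, H q = G q) (hp : p < a) (hab : a ≤ b)
    (hv : ∀ lam > 0, IsCellSolution H V p lam (v lam))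
    (hw : ∀ lam > 0, IsCellSolution G V p lam (w lam))
    (hve : ScaledLimsupLE v e) (he : e < -H a)
    (hw1 : ScaledLimsupLE w (-c)) : ScaledLimsupLE v (-c) := by
  intro R hR ε hε
  have hK0 : 0 ≤ K := by
    have := (abs_nonneg _).trans (hK 1 0)
    simpa using this
  have hmbar : 0 ≤ mbar := by linarith [(hV 0).1.trans (hV 0).2]
  set σ := a - p with hσ
  have hσ0 : 0 < σ := by linarith
  set η := ε / (2 * (K + 1 + R)) with hη
  have hη0 : 0 < η := by positivity
  have hηε : η * (K + 1 + R) = ε / 2 := by rw [hη]; field_simp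
  set C := |H p| + mbar + (|G p| + mbar) with hC
  have hC0 : 0 ≤ C := by positivity
  have hCη : 0 ≤ 2 * C / η := by positivity
  have hCσ : 0 ≤ 2 * C / σ := by positivity
  -- `1 + 2 * C / η` bounds `lam * |y₀|`, and `2 * C / σ` bounds the scaled length of the increasing
  -- branch; the spare unit makes `y₀` lie strictly beyond it.
  set R₂ := 2 + 2 * C / η + 2 * C / σ + R with hR₂
  have hR₂0 : 0 < R₂ := by positivity
  filter_upwards [hw1 R₂ hR₂0 (ε / 2) (by positivity),
    hve R₂ hR₂0 ((-H a - e) / 2) (by linarith), self_mem_nhdsWithin]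
    with lam hup hneg hlam y hy
  have hlam : 0 < lam := hlam
  have habs := (hv lam hlam).abs_le hlam hK' hV
  obtain ⟨Φ, y₀, hΦ, hΦd, hmax, hΦ1, hΦ2, hy₀⟩ :=
    exists_penalized_max (f := fun y => v lam y - w lam y) (C := C) (lam := lam) (η := η)
    ((hv lam hlam).continuous.sub (hw lam hlam).continuous) hlam hη0 (fun y => by
      rw [mul_sub]
      exact (abs_sub _ _).trans (add_le_add (habs y) ((hw lam hlam).abs_le hlam hK hV y)))
  have hvc := (hv lam hlam).continuous
  set D := R₂ / lam with hD
  have hD0 : 0 < D := by positivity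
  have hlD : lam * D = R₂ := by rw [hD]; field_simp
  have hnomin : ∀ x ∈ Ioo (-D) D, ¬ IsLocalMin (fun x => v lam x - (a - p) * x) x := by
    intro x hx hm
    have h1 := (hv lam hlam).super (fun x => (a - p) * x) (by fun_prop) x hm
    have h2 : deriv (fun x : ℝ => (a - p) * x) x = a - p := by
      simp
    simp only [h2, add_sub_cancel] at h1
    have h4 : |x| ≤ D := abs_le.2 ⟨by linarith [hx.1], by linarith [hx.2]⟩
    have h5 := hneg x (by rw [← hlD]; gcongr)
    linarith [(hV x).2]
  obtain ⟨z, hz, hmono, hanti⟩ := exists_monotoneOn_antitoneOn (by linarith)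
    (by fun_prop : ContinuousOn (fun x => v lam x - (a - p) * x) (Icc (-D) D)) hnomin
  -- On the increasing branch `lam * v` gains `σ` per unit of scaled length, and it is bounded, so
  -- the branch is short.
  have hz' : lam * z ≤ - R₂ + 2 * C / σ := by
    have h1 := hmono ⟨le_rfl, hz.1⟩ ⟨hz.1, le_rfl⟩ hz.1
    simp only at h1
    have h2 := mul_le_mul_of_nonneg_left h1 hlam.le
    have h3 := (abs_le.1 (habs z)).2
    have h4 := (abs_le.1 (habs (-D))).1
    have h5 : σ * (lam * z + R₂) ≤ 2 * C := by
      have : σ * (lam * z + R₂) = lam * (σ * z) - lam * (σ * -D) := by rw [← hlD]; ring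
      rw [this]
      have h6 : 0 ≤ |G p| + mbar := by positivity
      simp only [mul_sub lam] at h2
      linarith
    rw [← le_div_iff₀' hσ0] at h5
    linarith
  have hzy : z < y₀ := by
    by_contra! h
    have h1 := mul_le_mul_of_nonneg_left (neg_abs_le y₀) hlam.le
    have h2 := mul_le_mul_of_nonneg_left h hlam.le
    simp only [mul_neg] at h1
    simp only [hR₂] at hz'
    linarith
  have hyD : y₀ < D := by
    by_contra! h
    have h1 := mul_le_mul_of_nonneg_left (le_abs_self y₀) hlam.le
    have h2 := mul_le_mul_of_nonneg_left h hlam.le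
    simp only [hR₂] at hlD
    linarith
  have h1 := local_comparison_of_antitoneOn hK (fun q hq => hHG q (hq.trans hab)) (hv lam hlam)
    (hw lam hlam) hΦ (s := z) (t := D) ⟨hzy, hyD⟩ hanti hmax
  have h2 := mul_le_mul_of_nonneg_left (hΦd y₀) hK0
  have h3 := hup y (by simp only [hR₂]; linarith)
  have h4 := mul_le_mul_of_nonneg_left (hmax y) hlam.le
  have h5 := hΦ2 y
  have h6 : η * (1 + lam * |y|) ≤ η * (1 + R) := by gcongr
  simp only [mul_sub] at *
  linarith

/-! ### A lower bound by tents -/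

/-- The tent with tip `-κ / lam` at `z` and total gradients `a` and `0` on its sides is a
subsolution: on the sides by `h0`, `ha` and `V ≤ 0`, at the tip by the depth of `V z`. -/
theorem IsCellSolution.ge_tent {H : ℝ → ℝ} {V : BUC} {p lam a K κ M z : ℝ} {v : ℝ → ℝ}
    (hlam : 0 < lam) (hK : ∀ x y, |H x - H y| ≤ K * |x - y|) (hV : ∀ y, V y ≤ 0)
    (hv : IsCellSolution H V p lam v) (hp0 : 0 < p) (hpa : p < a)
    (h0 : H 0 ≤ κ) (ha : H a ≤ κ) (hM : ∀ q ∈ Icc 0 a, H q ≤ M) (hz : M + V z ≤ κ) (y : ℝ) :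
    -κ / lam - a * |y - z| ≤ v y := by
  set s : ℝ → ℝ := fun y => -κ / lam + min ((a - p) * (y - z)) (-p * (y - z)) with hs
  have hsc : Continuous s := by simp only [hs]; fun_prop
  have hsleft : ∀ y ≤ z, s y = -κ / lam + (a - p) * (y - z) := fun y hy => by
    simp only [hs]; rw [min_eq_left]; nlinarith
  have hsright : ∀ y, z ≤ y → s y = -κ / lam + -p * (y - z) := fun y hy => by
    simp only [hs]; rw [min_eq_right]; nlinarith
  have hsle : ∀ y, lam * s y ≤ -κ := fun y => by
    have h1 : s y ≤ -κ / lam := by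
      rcases le_total y z with h | h
      · rw [hsleft y h]; nlinarith
      · rw [hsright y h]; nlinarith
    rwa [le_div_iff₀' hlam] at h1
  have hslow : ∀ y, -κ / lam - a * |y - z| ≤ s y := fun y => by
    rcases le_total y z with h | h
    · rw [hsleft y h, abs_of_nonpos (by linarith)]; nlinarith
    · rw [hsright y h, abs_of_nonneg (by linarith)]; nlinarith
  have hsub : IsViscositySubsolution (fun y r q => lam * r + H (p + q) + V y) s := by
    intro φ hφ y hy
    have hφd := ((hφ.differentiable one_ne_zero) y).hasDerivAt
    have h1 := hsle y
    have h2 := hV y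
    rcases lt_trichotomy y z with h | rfl | h
    · have h3 : HasDerivAt s (a - p) y := by
        have h4 : HasDerivAt (fun y => -κ / lam + (a - p) * (y - z)) (a - p) y := by
          simpa using (((hasDerivAt_id y).sub_const z).const_mul (a - p)).const_add (-κ / lam)
        refine h4.congr_of_eventuallyEq ?_
        filter_upwards [Iio_mem_nhds h] with t ht using hsleft t (le_of_lt ht)
      have h5 := hy.hasDerivAt_eq_zero (h3.sub hφd)
      have h6 : p + deriv φ y = a := by linarith
      simp only [h6]
      linarith
    -- At the tip a test function has slope between those of the two sides, so its total gradient
    -- lies in `[0, a]`.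
    · have h3 : deriv φ y ≤ a - p := by
        refine deriv_le_of_antitoneOn (s := y - 1) (t := y + 1) hφ ⟨by linarith, by linarith⟩
          (fun x _ x' _ hxx' => ?_) hy
        simp only
        rcases le_total x y with h | h <;> rcases le_total x' y with h' | h'
        · rw [hsleft x h, hsleft x' h']; linarith
        · rw [hsleft x h, hsright x' h']; nlinarith
        · rw [hsright x h, hsleft x' h']; nlinarith
        · rw [hsright x h, hsright x' h']; nlinarith
      have h4 : -deriv φ y ≤ p := by
        have := deriv_le_of_antitoneOn (s := -y - 1) (t := -y + 1) (y := -y)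
          (v := fun x => s (-x)) (φ := fun x => φ (-x)) (q := p) (hφ.comp contDiff_neg)
          ⟨by linarith, by linarith⟩ (fun x _ x' _ hxx' => ?_) (isLocalMax_comp_neg hy)
        · rwa [deriv_comp_neg, neg_neg] at this
        · simp only
          rcases le_total (-x) y with h | h <;> rcases le_total (-x') y with h' | h'
          · rw [hsleft _ h, hsleft _ h']; nlinarith
          · rw [hsleft _ h, hsright _ h']; nlinarith
          · rw [hsright _ h, hsleft _ h']; nlinarith
          · rw [hsright _ h, hsright _ h']; nlinarith
      have h5 := hM (p + deriv φ y) ⟨by linarith, by linarith⟩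
      simp only
      linarith
    · have h3 : HasDerivAt s (-p) y := by
        have h4 : HasDerivAt (fun y => -κ / lam + -p * (y - z)) (-p) y := by
          simpa using (((hasDerivAt_id y).sub_const z).const_mul (-p)).const_add (-κ / lam)
        refine h4.congr_of_eventuallyEq ?_
        filter_upwards [Ioi_mem_nhds h] with t ht using hsright t (le_of_lt ht)
      have h5 := hy.hasDerivAt_eq_zero (h3.sub hφd)
      have h6 : p + deriv φ y = 0 := by linarith
      simp only [h6]
      linarith
  obtain ⟨C, hC⟩ := hv.bounded
  have hvc := hv.continuous
  set m := min p (a - p) with hm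
  have hm0 : 0 < m := lt_min hp0 (by linarith)
  -- The tent is unbounded below, so the comparison principle for bounded functions does not apply.
  -- But `s - v` attains its maximum, and local comparison there needs no penalization.
  have htop : Tendsto (fun y => v y - s y) (cocompact ℝ) atTop := by
    have h1 : Tendsto (fun y : ℝ => m * ‖y‖ - (m * |z| + C - κ / lam)) (cocompact ℝ) atTop :=
      tendsto_atTop_add_const_right _ _ ((tendsto_norm_cocompact_atTop).const_mul_atTop hm0)
    refine tendsto_atTop_mono (fun y => ?_) h1
    have h2 := (_root_.abs_le.1 (hC y)).1
    have h3 : s y ≤ -κ / lam - m * |y - z| := by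
      have h4 : m ≤ p := min_le_left _ _
      have h5 : m ≤ a - p := min_le_right _ _
      rcases le_total y z with h | h
      · rw [hsleft y h, abs_of_nonpos (by linarith)]; nlinarith
      · rw [hsright y h, abs_of_nonneg (by linarith)]; nlinarith
    have h4 : m * ‖y‖ ≤ m * (|y - z| + |z|) := by
      gcongr
      rw [Real.norm_eq_abs]
      simpa using abs_add_le (y - z) z
    rw [neg_div] at h3
    linarith
  obtain ⟨y₀, hy₀⟩ := (by fun_prop : Continuous fun y => v y - s y).exists_forall_le htop
  have h1 := local_comparison (y₀ := y₀) (Φ := fun _ => 0) hK V.continuous hsc hvc contDiff_const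
    (Eventually.of_forall fun y φ hφ h => hsub φ hφ y h) hv.super
    (Eventually.of_forall fun y => by have := hy₀ y; linarith)
  simp only [deriv_const, abs_zero, mul_zero] at h1
  have h2 : s y₀ - v y₀ ≤ 0 := by
    by_contra! h
    exact absurd h1 (not_le.2 (mul_pos hlam h))
  linarith [hy₀ y, hslow y]

/-- Deep points of the potential occur everywhere on the scale `1 / lam`. -/
def HasDenseMinima (V : BUC) (mbar : ℝ) : Prop :=
  ∀ R > 0, ∀ ε > 0, ∀ δ > 0, ∀ᶠ lam in 𝓝[>] (0 : ℝ), ∀ y, lam * |y| ≤ R →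
    ∃ z, lam * |y - z| ≤ ε ∧ V z ≤ -mbar + δ

theorem scaledLiminfGE_of_hasDenseMinima {H : ℝ → ℝ} {V : BUC} {p a K M mbar : ℝ}
    {v : ℝ → ℝ → ℝ} (hK : ∀ x y, |H x - H y| ≤ K * |x - y|) (hV : ∀ y, V y ≤ 0)
    (hmin : HasDenseMinima V mbar)
    (hv : ∀ lam > 0, IsCellSolution H V p lam (v lam)) (hp0 : 0 < p) (hpa : p < a)
    (h0 : H 0 ≤ M - mbar) (ha : H a ≤ M - mbar) (hM : ∀ q ∈ Icc 0 a, H q ≤ M) :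
    ScaledLiminfGE v (-(M - mbar)) := by
  intro R hR ε hε
  have ha0 : 0 < a := hp0.trans hpa
  filter_upwards [hmin R hR (ε / (2 * a)) (by positivity) (ε / 2) (by positivity),
    self_mem_nhdsWithin] with lam hgap hlam y hy
  have hlam : 0 < lam := hlam
  obtain ⟨z, hz, hVz⟩ := hgap y hy
  have h1 := (hv lam hlam).ge_tent hlam hK hV hp0 hpa (κ := M - mbar + ε / 2) (z := z) (by linarith)
    (by linarith) hM (by linarith) y
  have h2 := mul_le_mul_of_nonneg_left h1 hlam.le
  have h3 : lam * (-(M - mbar + ε / 2) / lam - a * |y - z|) =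
      -(M - mbar + ε / 2) - a * (lam * |y - z|) := by field_simp
  have h4 : a * (lam * |y - z|) ≤ ε / 2 := by
    calc _ ≤ a * (ε / (2 * a)) := by gcongr
      _ = ε / 2 := by field_simp
  linarith

/-! ### Return times of measure preserving maps -/

section ReturnTime

variable {X : Type*} [MeasurableSpace X] {μ : Measure X} {T : X → X} {E : Set X}

/-- The points of `E` that do not return to `E` during the next `m` steps. -/
def noReturn (T : X → X) (E : Set X) (m : ℕ) : Set X :=
  {x | x ∈ E ∧ ∀ j, 1 ≤ j → j ≤ m → T^[j] x ∉ E}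

theorem measurableSet_noReturn (hT : Measurable T) (hE : MeasurableSet E) (m : ℕ) :
    MeasurableSet (noReturn T E m) := by
  have : noReturn T E m = E ∩ ⋂ j, ⋂ (_ : 1 ≤ j), ⋂ (_ : j ≤ m), (T^[j]) ⁻¹' Eᶜ := by
    ext x; simp [noReturn]
  rw [this]
  exact hE.inter (MeasurableSet.iInter fun j => MeasurableSet.iInter fun _ =>
    MeasurableSet.iInter fun _ => (hT.iterate j) hE.compl)

/-- Among the times up to `M`, the last visit to `E` takes place at time `M - m` for at most one
`m`. So the preimages of `noReturn T E m` under `T^[M - m]` are disjoint, and they have the same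
measures. -/
theorem tsum_measure_noReturn_le [IsProbabilityMeasure μ] (hT : MeasurePreserving T μ μ)
    (hE : MeasurableSet E) : ∑' m, μ (noReturn T E m) ≤ 1 := by
  refine ENNReal.tsum_le_of_sum_range_le fun M => ?_
  have h1 : ∀ m, μ ((T^[M - m]) ⁻¹' noReturn T E m) = μ (noReturn T E m) := fun m =>
    (hT.iterate _).measure_preimage (measurableSet_noReturn hT.measurable hE m).nullMeasurableSet
  simp_rw [← h1]
  rw [← measure_biUnion_finset]
  · exact prob_le_one
  · have key : ∀ m m', m < m' → m' < M → ∀ x, T^[M - m] x ∈ noReturn T E m →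
        T^[M - m'] x ∈ noReturn T E m' → False := by
      intro m m' h h' x hx hx'
      apply hx'.2 (m' - m) (by omega) (by omega)
      rw [← Function.iterate_add_apply]
      have : m' - m + (M - m') = M - m := by omega
      rw [this]
      exact hx.1
    intro m hm m' hm' hne
    rw [Function.onFun, Set.disjoint_left]
    intro x hx hx'
    rcases lt_or_gt_of_ne hne with h | h
    · exact key m m' h (by simpa using hm') x hx hx'
    · exact key m' m h (by simpa using hm) x hx' hx
  · intro m _
    exact (hT.measurable.iterate _) (measurableSet_noReturn hT.measurable hE m)

/-- Borel–Cantelli: among the sets `noReturn T E (n / q)` each index occurs `q` times, so their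
measures sum to at most `q`. Gaps between visits are therefore eventually at most `n / q`, that is,
sublinear as `q` grows. -/
theorem ae_eventually_return [IsProbabilityMeasure μ] (hT : MeasurePreserving T μ μ)
    (hE : MeasurableSet E) (q : ℕ) [NeZero q] :
    ∀ᵐ x ∂μ, ∀ᶠ n in atTop, T^[n] x ∈ E → ∃ m, n < m ∧ m ≤ n + n / q ∧ T^[m] x ∈ E := by
  have hsum : ∑' n, μ ((T^[n]) ⁻¹' noReturn T E (n / q)) ≠ ⊤ := by
    have h1 : ∀ n, μ ((T^[n]) ⁻¹' noReturn T E (n / q)) = μ (noReturn T E (n / q)) := fun n =>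
      (hT.iterate _).measure_preimage (measurableSet_noReturn hT.measurable hE _).nullMeasurableSet
    simp_rw [h1]
    have h2 : ∑' n : ℕ, μ (noReturn T E (n / q)) =
        ∑' k : ℕ × Fin q, μ (noReturn T E k.1) :=
      (Nat.divModEquiv q).tsum_eq (fun k : ℕ × Fin q => μ (noReturn T E k.1))
    rw [h2, ENNReal.tsum_prod (f := fun m (_ : Fin q) => μ (noReturn T E m))]
    simp only [tsum_fintype, Finset.sum_const, Finset.card_univ, Fintype.card_fin, nsmul_eq_mul]
    rw [ENNReal.tsum_mul_left]
    exact ENNReal.mul_ne_top (ENNReal.natCast_ne_top q)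
      ((tsum_measure_noReturn_le hT hE).trans_lt ENNReal.one_lt_top).ne
  filter_upwards [ae_eventually_notMem hsum] with x hx
  filter_upwards [hx] with n hn hnE
  by_contra! hcon
  refine hn ⟨hnE, fun j h1 h2 h3 => hcon (n + j) (by omega) (by omega) ?_⟩
  rwa [add_comm, Function.iterate_add_apply]

theorem ae_exists_visit [IsProbabilityMeasure μ] (hT : MeasurePreserving T μ μ)
    (hE : MeasurableSet E) (q : ℕ) [NeZero q] :
    ∀ᵐ x ∂μ, (∃ᶠ n in atTop, T^[n] x ∈ E) →
      ∃ N, ∀ n ≥ N, ∃ m, n ≤ m ∧ m ≤ n + n / q ∧ T^[m] x ∈ E := by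
  filter_upwards [ae_eventually_return hT hE q] with x hx hfreq
  obtain ⟨N₀, hN₀⟩ := eventually_atTop.1 hx
  obtain ⟨N, hN, hNE⟩ := frequently_atTop.1 hfreq N₀
  refine ⟨N, fun n hn => ?_⟩
  induction n, hn using Nat.le_induction with
  | base => exact ⟨N, le_rfl, Nat.le_add_right _ _, hNE⟩
  | succ n hn ih =>
    obtain ⟨m, h1, h2, h3⟩ := ih
    have hdiv : n / q ≤ (n + 1) / q := Nat.div_le_div_right (by omega)
    -- The visit found for `n` still serves for `n + 1` unless it happens exactly at time `n`; then
    -- the next return replaces it.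
    rcases h1.eq_or_lt with rfl | h1
    · obtain ⟨m', h4, h5, h6⟩ := hN₀ n (by omega) h3
      exact ⟨m', h4, by omega, h6⟩
    · exact ⟨m, h1, by omega, h3⟩

end ReturnTime

/-! ### The space of potentials -/

theorem measurable_eval (x : ℝ) : Measurable fun V : BUC => V x := by
  rw [measurable_iff_comap_le, BorelSpace.measurable_eq (α := ℝ)]
  exact le_iSup (fun x : ℝ => MeasurableSpace.comap (fun V : BUC => V x) (borel ℝ)) x

theorem measurable_translate (y : ℝ) : Measurable (translate y) := by
  rw [measurable_iff_comap_le]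
  change MeasurableSpace.comap _ (⨆ x : ℝ, MeasurableSpace.comap (fun V : BUC => V x) (borel ℝ)) ≤ _
  rw [MeasurableSpace.comap_iSup]
  refine iSup_le fun x => ?_
  rw [MeasurableSpace.comap_comp, ← BorelSpace.measurable_eq (α := ℝ)]
  exact (measurable_eval (x + y)).comap_le

theorem translate_translate (x y : ℝ) (V : BUC) :
    translate x (translate y V) = translate (x + y) V :=
  Subtype.ext (funext fun t => congrArg V.1 (add_assoc t x y))

theorem translate_zero (V : BUC) : translate 0 V = V :=
  Subtype.ext (funext fun t => congrArg V.1 (add_zero t))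

theorem translate_iterate (s : ℝ) (n : ℕ) (V : BUC) :
    (translate s)^[n] V = translate (n * s) V := by
  induction n with
  | zero => simp [translate_zero]
  | succ n ih =>
    rw [Function.iterate_succ_apply', ih, translate_translate]
    congr 1; push_cast; ring

theorem IsAdmissibleLaw.measurePreserving {P : Measure BUC} {mbar : ℝ}
    (hP : IsAdmissibleLaw P mbar) (y : ℝ) : MeasurePreserving (translate y) P P := by
  refine ⟨measurable_translate y, Measure.ext fun s hs => ?_⟩
  rw [Measure.map_apply (measurable_translate y) hs, ← hP.stationary s hs (-y)]
  congr 1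
  ext V
  refine ⟨fun h => ⟨translate y V, h, ?_⟩, ?_⟩
  · rw [translate_translate, neg_add_cancel, translate_zero]
  · rintro ⟨W, hW, rfl⟩
    rw [mem_preimage, translate_translate, add_neg_cancel, translate_zero]
    exact hW

/-- For continuous functions almost everywhere bounds hold everywhere, because an open null set is
empty. -/
theorem le_and_exists_lt_of_essSup_eq {f : ℝ → ℝ} {c : ℝ} (hf : Continuous f)
    (hb : ∃ C, ∀ x, |f x| ≤ C) (h : essSup f volume = c) :
    (∀ x, f x ≤ c) ∧ ∀ θ < c, ∃ x, θ < f x := by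
  obtain ⟨C, hC⟩ := hb
  constructor
  · have h1 : ∀ᵐ x ∂(volume : Measure ℝ), f x ≤ c := by
      rw [← h]
      exact ae_le_essSup (isBoundedUnder_of ⟨C, fun x => (abs_le.1 (hC x)).2⟩)
    have h2 : IsOpen {x | c < f x} := isOpen_lt continuous_const hf
    have h3 : volume {x | c < f x} = 0 := by
      rw [ae_iff] at h1
      simpa using h1
    have h4 := (h2.measure_eq_zero_iff (μ := (volume : Measure ℝ))).1 h3
    intro x
    by_contra! hx
    exact (h4 ▸ hx : x ∈ (∅ : Set ℝ))
  · intro θ hθ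
    by_contra! hcon
    have h1 : essSup f volume ≤ θ := by
      refine essSup_le_of_ae_le θ (Eventually.of_forall hcon) ?_
      exact (isBoundedUnder_of ⟨-C, fun x => (abs_le.1 (hC x)).1⟩ :
        IsBoundedUnder (· ≥ ·) (ae volume) f).isCoboundedUnder_le
    linarith

theorem IsAdmissibleLaw.ae_range {P : Measure BUC} {mbar : ℝ} (hP : IsAdmissibleLaw P mbar) :
    ∀ᵐ V ∂P, (∀ y, V y ∈ Icc (-mbar) 0) ∧ (∀ θ < 0, ∃ y, θ < V y) ∧
      ∀ θ > -mbar, ∃ y, V y < θ := by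
  filter_upwards [hP.esssup_eq, hP.esssup_neg_eq] with V h1 h2
  have h3 := le_and_exists_lt_of_essSup_eq V.continuous V.2.1 h1
  have h4 := le_and_exists_lt_of_essSup_eq V.continuous.neg
    (V.2.1.imp fun C hC x => by simpa using hC x) h2
  refine ⟨fun y => ⟨?_, h3.1 y⟩, h3.2, fun θ hθ => ?_⟩
  · have := h4.1 y
    simp only [Pi.neg_apply] at this
    linarith
  · obtain ⟨y, hy⟩ := h4.2 (-θ) (by linarith)
    simp only [Pi.neg_apply] at hy
    exact ⟨y, by linarith⟩

/-- The potentials that are less than `θ` at a rational point of `[0, 1]`. -/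
def deepSet (θ : ℝ) : Set BUC := {V | ∃ r : ℚ, (r : ℝ) ∈ Icc (0 : ℝ) 1 ∧ V r < θ}

theorem measurableSet_deepSet (θ : ℝ) : MeasurableSet (deepSet θ) := by
  have : deepSet θ = ⋃ r : ℚ, ⋃ (_ : (r : ℝ) ∈ Icc (0 : ℝ) 1), {V : BUC | V r < θ} := by
    ext V; simp [deepSet]
  rw [this]
  exact MeasurableSet.iUnion fun r => MeasurableSet.iUnion fun _ =>
    measurableSet_lt (measurable_eval r) measurable_const

theorem exists_translate_mem_deepSet {V : BUC} {θ y : ℝ} (hy : V y < θ) :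
    ∃ k : ℤ, translate k V ∈ deepSet θ := by
  have hc := V.continuous
  have h1 : ∀ᶠ t in 𝓝 y, V t < θ := (hc.tendsto y).eventually_lt_const hy
  obtain ⟨l, u, ⟨hl, hu⟩, h2⟩ := mem_nhds_iff_exists_Ioo_subset.1 h1
  obtain ⟨r, hr1, hr2⟩ := exists_rat_btwn (hl.trans hu)
  refine ⟨⌊(r : ℝ)⌋, r - ⌊(r : ℝ)⌋, ?_, ?_⟩
  · push_cast
    exact ⟨by linarith [Int.floor_le (r : ℝ)], by linarith [Int.lt_floor_add_one (r : ℝ)]⟩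
  · have : V (((r - ⌊(r : ℝ)⌋ : ℚ) : ℝ) + (⌊(r : ℝ)⌋ : ℝ)) < θ := by
      push_cast
      rw [sub_add_cancel]
      exact h2 ⟨hr1, hr2⟩
    exact this

/-- Almost every `V` is deep somewhere, hence some integer translate lies in `deepSet θ`. Poincaré
recurrence gives infinitely many visits in the direction `s = ±1`, and the return time estimate
bounds their gaps. -/
theorem IsAdmissibleLaw.ae_exists_deep {P : Measure BUC} {mbar : ℝ} (hP : IsAdmissibleLaw P mbar)
    {s : ℤ} (hs : s * s = 1) {θ : ℝ} (hθ : -mbar < θ) (q : ℕ) [NeZero q] :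
    ∀ᵐ V ∂P, ∃ N : ℕ, ∀ n ≥ N, ∃ m, n ≤ m ∧ m ≤ n + n / q ∧
      translate (m * s) V ∈ deepSet θ := by
  have := hP.prob
  have hE := measurableSet_deepSet θ
  have hrec : ∀ᵐ V ∂P, ∀ k : ℤ, translate k V ∈ deepSet θ →
      ∃ᶠ n in atTop, (translate s)^[n] (translate k V) ∈ deepSet θ := by
    rw [ae_all_iff]
    intro k
    exact (hP.measurePreserving k).quasiMeasurePreserving.ae
      ((hP.measurePreserving s).conservative.ae_mem_imp_frequently_image_mem hE.nullMeasurableSet)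
  filter_upwards [hrec, hP.ae_range, ae_exists_visit (hP.measurePreserving s) hE q]
    with V h1 h2 h3
  obtain ⟨y, hy⟩ := h2.2.2 θ hθ
  obtain ⟨k, hk⟩ := exists_translate_mem_deepSet hy
  have hfreq : ∃ᶠ n in atTop, (translate s)^[n] V ∈ deepSet θ := by
    rw [frequently_atTop]
    intro N
    obtain ⟨n, hn, hnE⟩ := frequently_atTop.1 (h1 k hk) (N + k.natAbs)
    have hsk : |s * k| = |k| := by
      have : |s| = 1 := by
        have h4 : |s| * |s| = 1 := by rw [← abs_mul, hs, abs_one]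
        nlinarith [abs_nonneg s]
      rw [abs_mul, this, one_mul]
    have h5 : -(k.natAbs : ℤ) ≤ s * k := by
      rw [Int.natCast_natAbs, ← hsk]; exact neg_abs_le _
    -- Since `s * s = 1`, `n` steps from the translate by `k` are `n + s * k` steps from `V`; the
    -- choice `n ≥ N + |k|` keeps this at least `N`.
    refine ⟨(n + s * k).toNat, by omega, ?_⟩
    rw [translate_iterate, translate_translate] at hnE
    rw [translate_iterate]
    have h6 : (((n + s * k).toNat : ℕ) : ℝ) = n + s * k := by
      have : (((n + s * k).toNat : ℕ) : ℤ) = n + s * k := Int.toNat_of_nonneg (by omega)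
      exact_mod_cast this
    have hs' : (s : ℝ) * s = 1 := by exact_mod_cast hs
    have h7 : ((n : ℝ) + s * k) * s = n * s + k := by
      linear_combination (k : ℝ) * hs'
    rwa [h6, h7]
  obtain ⟨N, hN⟩ := h3 hfreq
  refine ⟨N, fun n hn => ?_⟩
  obtain ⟨m, h4, h5, h6⟩ := hN n hn
  exact ⟨m, h4, h5, by rwa [translate_iterate] at h6⟩

theorem IsAdmissibleLaw.ae_hasDenseMinima {P : Measure BUC} {mbar : ℝ}
    (hP : IsAdmissibleLaw P mbar) : ∀ᵐ V ∂P, HasDenseMinima V mbar := by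
  have h : ∀ᵐ V ∂P, ∀ s : ({1, -1} : Set ℤ), ∀ j q : ℕ, ∃ N : ℕ, ∀ n ≥ N, ∃ m, n ≤ m ∧
      m ≤ n + n / (q + 1) ∧ translate (m * (s : ℤ)) V ∈ deepSet (-mbar + 1 / ((j : ℝ) + 1)) := by
    simp only [ae_all_iff]
    rintro ⟨s, hs⟩ j q
    have : (0 : ℝ) < 1 / ((j : ℝ) + 1) := by positivity
    exact hP.ae_exists_deep (by rcases hs with rfl | rfl <;> norm_num) (by linarith) (q + 1)
  filter_upwards [h] with V hV R hR ε hε δ hδ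
  obtain ⟨j, hj⟩ := exists_nat_one_div_lt hδ
  -- At distance `t ≤ R / lam` the relative gap `1 / (q + 1)` costs at most `ε / 2` after scaling;
  -- the other half absorbs the additive constant, which depends on `N` and vanishes with `lam`.
  obtain ⟨q, hq⟩ := exists_nat_one_div_lt (by positivity : 0 < ε / (2 * R))
  have key : ∀ s : ({1, -1} : Set ℤ), ∀ᶠ lam in 𝓝[>] (0 : ℝ), ∀ t, 0 ≤ t → lam * t ≤ R →
      ∃ z, lam * |s.1 * t - z| ≤ ε ∧ V z ≤ -mbar + δ := by
    intro s
    obtain ⟨N, hN⟩ := hV s j q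
    have hsmall : ∀ᶠ lam in 𝓝[>] (0 : ℝ), lam < ε / (2 * (2 * (1 + N) + 1)) :=
      nhdsWithin_le_nhds (eventually_lt_nhds (by positivity))
    filter_upwards [hsmall, self_mem_nhdsWithin] with lam hlam hpos t ht0 htR
    have hpos : 0 < lam := hpos
    obtain ⟨m, h1, h2, r, hr, hVr⟩ := hN (max ⌈t⌉₊ N) (le_max_right _ _)
    refine ⟨r + m * s.1, ?_, ?_⟩
    · have habs : |(s.1 : ℝ)| = 1 := by
        rcases s with ⟨s, rfl | rfl⟩ <;> simp
      have h3 : t ≤ m := (Nat.le_ceil t).trans (by exact_mod_cast (le_max_left _ _).trans h1)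
      have h4 : ((max ⌈t⌉₊ N : ℕ) : ℝ) ≤ t + 1 + N := by
        have h5 := Nat.ceil_lt_add_one ht0
        rw [Nat.cast_max]
        exact max_le (by linarith [(Nat.cast_nonneg N : (0 : ℝ) ≤ N)]) (by linarith)
      have h6 : (m : ℝ) ≤ (t + 1 + N) + (t + 1 + N) * (1 / (q + 1)) := by
        have h7 : (m : ℝ) ≤ ((max ⌈t⌉₊ N : ℕ) : ℝ) + ((max ⌈t⌉₊ N / (q + 1) : ℕ) : ℝ) := by
          exact_mod_cast h2
        have h8 : ((max ⌈t⌉₊ N / (q + 1) : ℕ) : ℝ) ≤ (t + 1 + N) * (1 / (q + 1)) := by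
          refine Nat.cast_div_le.trans ?_
          rw [mul_one_div]
          push_cast
          gcongr
          exact_mod_cast h4
        linarith
      have h9 : 1 / ((q : ℝ) + 1) ≤ 1 := by
        rw [div_le_one (by positivity)]; linarith [(Nat.cast_nonneg q : (0 : ℝ) ≤ q)]
      have h10 : |(s.1 : ℝ) * t - (r + m * s.1)| ≤ (m - t) + 1 := by
        calc |(s.1 : ℝ) * t - (r + m * s.1)| = |(s.1 : ℝ) * (t - m) - r| := by
              congr 1; ring
          _ ≤ |(s.1 : ℝ) * (t - m)| + |(r : ℝ)| := abs_sub _ _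
          _ = (m - t) + r := by
              rw [abs_mul, habs, one_mul, abs_of_nonpos (by linarith), abs_of_nonneg hr.1]; ring
          _ ≤ _ := by linarith [hr.2]
      have h11 : (m - t) + 1 ≤ 2 * (1 + N) + 1 + t * (1 / ((q : ℝ) + 1)) := by
        have : (1 + N) * (1 / ((q : ℝ) + 1)) ≤ 1 + N := mul_le_of_le_one_right (by positivity) h9
        linarith
      have h12 : lam * (2 * (1 + N) + 1) ≤ ε / 2 := by
        rw [lt_div_iff₀ (by positivity)] at hlam
        linarith
      have h13 : lam * t * (1 / ((q : ℝ) + 1)) ≤ ε / 2 := by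
        calc lam * t * (1 / ((q : ℝ) + 1)) ≤ R * (ε / (2 * R)) := by gcongr
          _ = ε / 2 := by field_simp
      calc lam * |(s.1 : ℝ) * t - (r + m * s.1)|
          ≤ lam * (2 * (1 + N) + 1 + t * (1 / ((q : ℝ) + 1))) := by
            gcongr; exact h10.trans h11
        _ = lam * (2 * (1 + N) + 1) + lam * t * (1 / ((q : ℝ) + 1)) := by ring
        _ ≤ ε := by linarith
    · have : V (r + m * s.1) < -mbar + 1 / ((j : ℝ) + 1) := hVr
      linarith
  filter_upwards [key ⟨1, by simp⟩, key ⟨-1, by simp⟩] with lam h1 h2 y hy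
  rcases le_total 0 y with h | h
  · rw [abs_of_nonneg h] at hy
    simpa using h1 y h hy
  · rw [abs_of_nonpos h] at hy
    simpa using h2 (-y) (by linarith) hy

/-! ### Regular homogenization in terms of scaled limits -/

/-- In the definition the exceptional null set may depend on `R`; countably many radii suffice to
obtain one null set for all of them. -/
theorem RegularlyHomogenizableAt.ae_scaled {P : Measure BUC} {H : ℝ → ℝ} {p c : ℝ}
    (h : RegularlyHomogenizableAt P H p c) :
    ∀ᵐ V ∂P, ∀ v : ℝ → ℝ → ℝ, (∀ lam > 0, IsCellSolution H V p lam (v lam)) →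
      ScaledLimsupLE v (-c) ∧ ScaledLiminfGE v (-c) := by
  have h1 : ∀ᵐ V ∂P, ∀ n : ℕ, ∀ v : ℝ → ℝ → ℝ,
      (∀ lam : ℝ, 0 < lam → IsCellSolution H V p lam (v lam)) →
      Tendsto (fun lam : ℝ => sSup ((fun y : ℝ => |lam * v lam y + c|) ''
        Icc (-(((n : ℝ) + 1) / lam)) (((n : ℝ) + 1) / lam))) (𝓝[>] 0) (𝓝 0) :=
    ae_all_iff.2 fun n => h.tendsto (n + 1) (by positivity)
  filter_upwards [h1] with V hV v hv
  have key : ∀ R > 0, ∀ ε > 0, ∀ᶠ lam in 𝓝[>] (0 : ℝ), ∀ y, lam * |y| ≤ R →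
      |lam * v lam y + c| ≤ ε := by
    intro R hR ε hε
    obtain ⟨n, hn⟩ := exists_nat_gt R
    filter_upwards [(hV n v hv).eventually_lt_const hε, self_mem_nhdsWithin] with lam h2 hlam y hy
    have hlam : 0 < lam := hlam
    have hc := (hv lam hlam).continuous
    have hbdd : BddAbove ((fun y : ℝ => |lam * v lam y + c|) ''
        Icc (-(((n : ℝ) + 1) / lam)) (((n : ℝ) + 1) / lam)) :=
      (isCompact_Icc.image (by fun_prop)).bddAbove
    have hmem : y ∈ Icc (-(((n : ℝ) + 1) / lam)) (((n : ℝ) + 1) / lam) := by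
      rw [mem_Icc, ← abs_le, le_div_iff₀' hlam]
      linarith
    exact (le_csSup hbdd ⟨y, hmem, rfl⟩).trans h2.le
  constructor <;> intro R hR ε hε <;> filter_upwards [key R hR ε hε] with lam h2 y hy
  · linarith [(abs_le.1 (h2 y hy)).2]
  · linarith [(abs_le.1 (h2 y hy)).1]

theorem tendsto_of_scaled {v : ℝ → ℝ → ℝ} {c R : ℝ} (hR : 0 < R) (h1 : ScaledLimsupLE v (-c))
    (h2 : ScaledLiminfGE v (-c)) :
    Tendsto (fun lam : ℝ => sSup ((fun y : ℝ => |lam * v lam y + c|) '' Icc (-(R / lam)) (R / lam)))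
      (𝓝[>] 0) (𝓝 0) := by
  rw [Metric.tendsto_nhds]
  intro ε hε
  filter_upwards [h1 R hR (ε / 2) (by positivity), h2 R hR (ε / 2) (by positivity),
    self_mem_nhdsWithin] with lam h3 h4 hlam
  have hlam : 0 < lam := hlam
  rw [Real.dist_eq, sub_zero, abs_of_nonneg]
  · refine lt_of_le_of_lt (Real.sSup_le ?_ (by positivity)) (half_lt_self hε)
    rintro _ ⟨y, hy, rfl⟩
    rw [mem_Icc, ← abs_le, le_div_iff₀' hlam] at hy
    exact abs_le.2 ⟨by linarith [h4 y hy], by linarith [h3 y hy]⟩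
  · refine Real.sSup_nonneg ?_
    rintro _ ⟨y, -, rfl⟩
    exact abs_nonneg _

theorem RegularlyHomogenizableAt.exists_family {P : Measure BUC} {H : ℝ → ℝ} {p c : ℝ}
    (h : RegularlyHomogenizableAt P H p c) (V : BUC) :
    ∃ v : ℝ → ℝ → ℝ, ∀ lam > 0, IsCellSolution H V p lam (v lam) := by
  choose! v hv _ using h.wellPosed V
  exact ⟨v, hv⟩

/-- Constants are sub- and supersolutions because `-mbar ≤ V ≤ 0`. -/
theorem RegularlyHomogenizableAt.mem_Icc {P : Measure BUC} {H : ℝ → ℝ} {p c mbar K : ℝ}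
    (h : RegularlyHomogenizableAt P H p c) (hP : IsAdmissibleLaw P mbar)
    (hK : ∀ x y, |H x - H y| ≤ K * |x - y|) : c ∈ Icc (H p - mbar) (H p) := by
  have := hP.prob
  obtain ⟨V, h1, h2⟩ := (h.ae_scaled.and hP.ae_range).exists
  obtain ⟨v, hv⟩ := h.exists_family V
  obtain ⟨h3, h4⟩ := h1 v hv
  constructor
  · have := h4.le (ScaledLimsupLE.of_forall fun lam hlam y =>
      (hv lam hlam).le_neg hlam hK (fun y => (h2.1 y).1) y)
    linarith
  · have : ScaledLiminfGE v (-H p) := by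
      intro R hR ε hε
      filter_upwards [self_mem_nhdsWithin] with lam hlam y _
      linarith [(hv lam hlam).neg_le hlam hK (fun y => (h2.1 y).2) y]
    linarith [this.le h3]

/-! ### The effective Hamiltonian near the barrier -/

/-- The potentials that are at least `θ` at the rational points of `[0, ℓ]`. -/
def highSet (θ ℓ : ℝ) : Set BUC := {V | ∀ r : ℚ, (r : ℝ) ∈ Icc (0 : ℝ) ℓ → θ ≤ V r}

theorem measurableSet_highSet (θ ℓ : ℝ) : MeasurableSet (highSet θ ℓ) := by
  have : highSet θ ℓ = ⋂ r : ℚ, ⋂ (_ : (r : ℝ) ∈ Icc (0 : ℝ) ℓ), {V : BUC | θ ≤ V r} := by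
    ext V; simp [highSet]
  rw [this]
  exact MeasurableSet.iInter fun r => MeasurableSet.iInter fun _ =>
    measurableSet_le measurable_const (measurable_eval r)

theorem le_of_mem_highSet {V : BUC} {θ ℓ : ℝ} (h : V ∈ highSet θ ℓ) {x : ℝ}
    (hx : x ∈ Ioo 0 ℓ) : θ ≤ V x := by
  by_contra! hlt
  have h1 : ∀ᶠ t in 𝓝 x, V t < θ := (V.continuous.tendsto x).eventually_lt_const hlt
  obtain ⟨l, u, ⟨hl, hu⟩, h2⟩ := mem_nhds_iff_exists_Ioo_subset.1
    (h1.and (Ioo_mem_nhds hx.1 hx.2))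
  obtain ⟨r, hr1, hr2⟩ := exists_rat_btwn (hl.trans hu)
  have h3 := h2 ⟨hr1, hr2⟩
  exact absurd (h r ⟨h3.2.1.le, h3.2.2.le⟩) (not_le.2 h3.1)

theorem exists_translate_mem_highSet {V : BUC} {θ y : ℝ} (hy : θ < V y) :
    ∃ (x : ℚ) (j : ℕ), translate x V ∈ highSet θ (1 / ((j : ℝ) + 1)) := by
  have h1 : ∀ᶠ t in 𝓝 y, θ < V t := (V.continuous.tendsto y).eventually_const_lt hy
  obtain ⟨l, u, ⟨hl, hu⟩, h2⟩ := mem_nhds_iff_exists_Ioo_subset.1 h1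
  obtain ⟨x, hx1, hx2⟩ := exists_rat_btwn (hl.trans hu)
  obtain ⟨j, hj⟩ := exists_nat_one_div_lt (sub_pos.2 hx2)
  refine ⟨x, j, fun r hr => le_of_lt (h2 ⟨?_, ?_⟩)⟩
  · linarith [hr.1]
  · linarith [hr.2]

/-- If the level of the effective Hamiltonian is below the barrier, then the slope of the
solutions is at most `b`, and smaller than that where the potential is high. -/
theorem sum_indicator_highSet_le {G : ℝ → ℝ} {V : BUC} {p b lam mbar K ℓ δ c : ℝ} {N : ℕ}
    {v : ℝ → ℝ} (hlam : 0 < lam) (hK0 : 0 < K) (hK : ∀ x y, |G x - G y| ≤ K * |x - y|)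
    (hmbar : 0 < mbar) (hV : ∀ y, -mbar ≤ V y) (hb : ∀ q ≥ b, G b ≤ G q)
    (hv : IsCellSolution G V p lam v) (hℓ : 0 < ℓ) (hℓ1 : ℓ ≤ 1)
    (hlow : ∀ y ∈ Icc (0 : ℝ) N, |lam * v y + c| ≤ δ) (hδ : c + δ < G b - mbar) :
    mbar / (2 * K) * ℓ * ∑ i ∈ Finset.range N,
      (highSet (-mbar / 2) ℓ).indicator (fun _ => (1 : ℝ)) (translate i V) ≤
      (b - p) * N + 2 * δ / lam := by
  -- Where `V ≥ -mbar / 2`, the equation puts `G (p + φ')` below `G b` by at least `mbar / 2`; the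
  -- Lipschitz bound turns this into a gradient deficit `γ`.
  set γ := mbar / (2 * K) with hγ
  have hγ0 : 0 < γ := by positivity
  have hKγ : K * γ = mbar / 2 := by rw [hγ]; field_simp
  have hvc := hv.continuous
  have htest : ∀ φ : ℝ → ℝ, ContDiff ℝ 1 φ → ∀ y ∈ Ioo (0 : ℝ) N,
      IsLocalMax (fun x => v x - φ x) y →
      deriv φ y ≤ b - p ∧ (-mbar / 2 ≤ V y → deriv φ y ≤ b - γ - p) := by
    intro φ hφ y hy h
    have h1 := hv.sub φ hφ y h
    have h2 := (abs_le.1 (hlow y ⟨hy.1.le, hy.2.le⟩)).1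
    have h3 := hV y
    simp only at h1
    have h4 : p + deriv φ y < b := by
      by_contra! h5
      linarith [hb _ h5]
    refine ⟨by linarith, fun h5 => ?_⟩
    have h6 := (le_abs_self _).trans (hK b (p + deriv φ y))
    rw [abs_of_pos (by linarith)] at h6
    have h7 : K * γ ≤ K * (b - (p + deriv φ y)) := by rw [hKγ]; linarith
    have h8 := le_of_mul_le_mul_left h7 hK0
    linarith
  have hanti := antitoneOn_sub_of_test_le hvc (a := 0) (b := N) (q := b - p)
    fun φ hφ y hy h => (htest φ hφ y hy h).1
  set g : ℝ → ℝ := fun x => v x - (b - p) * x with hg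
  -- Each unit cell that starts with a high stretch makes the nonincreasing function `g` lose at
  -- least `γ * ℓ`; the losses telescope.
  have hstep : ∀ i ∈ Finset.range N, γ * ℓ *
      (highSet (-mbar / 2) ℓ).indicator (fun _ => (1 : ℝ)) (translate i V) ≤
      g i - g ((i + 1 : ℕ) : ℝ) := by
    intro i hi
    have hiN : ((i + 1 : ℕ) : ℝ) ≤ N := by exact_mod_cast Finset.mem_range.1 hi
    push_cast at hiN ⊢
    have hi0 : (0 : ℝ) ≤ i := Nat.cast_nonneg i
    by_cases hE : translate i V ∈ highSet (-mbar / 2) ℓ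
    · rw [indicator_of_mem hE, mul_one]
      have h1 := antitoneOn_sub_of_test_le hvc (a := i) (b := i + ℓ) (q := b - γ - p)
        (fun φ hφ y hy h => (htest φ hφ y ⟨by linarith [hy.1], by linarith [hy.2]⟩ h).2 (by
          have := le_of_mem_highSet hE (x := y - i) ⟨by linarith [hy.1], by linarith [hy.2]⟩
          have e : (translate i V) (y - i) = V y := congrArg V.1 (sub_add_cancel y _)
          rwa [e] at this))
        (left_mem_Icc.2 (by linarith)) (right_mem_Icc.2 (by linarith)) (by linarith)
      have h2 := hanti (a := (i : ℝ) + ℓ) (b := i + 1) ⟨by linarith, by linarith⟩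
        ⟨by linarith, by linarith⟩ (by linarith)
      simp only [hg] at *
      linarith
    · rw [indicator_of_notMem hE, mul_zero]
      have h2 := hanti (a := (i : ℝ)) (b := i + 1) ⟨by linarith, by linarith⟩
        ⟨by linarith, by linarith⟩ (by linarith)
      simp only [hg] at *
      linarith
  rw [Finset.mul_sum]
  refine (Finset.sum_le_sum hstep).trans ?_
  rw [Finset.sum_range_sub' (fun i : ℕ => g i)]
  have h1 := (abs_le.1 (hlow 0 ⟨le_rfl, Nat.cast_nonneg N⟩)).2
  have h2 := (abs_le.1 (hlow N ⟨Nat.cast_nonneg N, le_rfl⟩)).1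
  have h3 : v 0 - v N ≤ 2 * δ / lam := by
    rw [le_div_iff₀' hlam, mul_sub]; linarith
  simp only [hg, Nat.cast_zero, mul_zero, sub_zero]
  linarith

theorem IsEffectiveHamiltonian.exists_le_left_of_barrier {P : Measure BUC} {G Gbar : ℝ → ℝ}
    {b mbar K : ℝ} (hP : IsAdmissibleLaw P mbar) (hK0 : 0 < K)
    (hK : ∀ x y, |G x - G y| ≤ K * |x - y|) (hb : ∀ q ≥ b, G b ≤ G q)
    (hG : IsEffectiveHamiltonian P G Gbar) :
    ∃ e > 0, ∀ p ∈ Icc (b - e) b, G b - mbar ≤ Gbar p := by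
  have := hP.prob
  have hmbar := hP.mbar_pos
  by_contra! hcon
  have hex : ∀ n : ℕ, ∃ p ∈ Icc (b - 1 / ((n : ℝ) + 1)) b, Gbar p < G b - mbar := fun n =>
    hcon _ (by positivity)
  choose p hp hpG using hex
  set γ := mbar / (2 * K) with hγ
  have hγ0 : 0 < γ := by positivity
  have hae : ∀ᵐ V ∂P, ∀ n, ∀ v : ℝ → ℝ → ℝ, (∀ lam > 0, IsCellSolution G V (p n) lam (v lam)) →
      ScaledLimsupLE v (-Gbar (p n)) ∧ ScaledLiminfGE v (-Gbar (p n)) :=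
    ae_all_iff.2 fun n => (hG (p n)).ae_scaled
  -- high values of the potential have density zero
  have hfreq : ∀ ℓ, 0 < ℓ → ℓ ≤ 1 → ∀ᵐ V ∂P, Tendsto (fun N : ℕ =>
      (∑ i ∈ Finset.range N,
        (highSet (-mbar / 2) ℓ).indicator (fun _ => (1 : ℝ)) (translate i V)) / N)
      atTop (𝓝 0) := by
    intro ℓ hℓ hℓ1
    filter_upwards [hae, hP.ae_range] with V h1 h2
    have hnn : ∀ i : ℕ, 0 ≤ (highSet (-mbar / 2) ℓ).indicator (fun _ => (1 : ℝ)) (translate i V) :=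
      fun i => indicator_nonneg (fun _ _ => zero_le_one) _
    rw [Metric.tendsto_atTop']
    intro ε hε
    obtain ⟨n, hn⟩ := exists_nat_one_div_lt (by positivity : 0 < γ * ℓ * ε / 2)
    obtain ⟨v, hv⟩ := (hG (p n)).exists_family V
    obtain ⟨h3, h4⟩ := h1 n v hv
    -- The first term keeps the solution strictly on the far side of the barrier level; the second,
    -- together with `b - p n < γ * ℓ * ε / 2`, makes the frequency less than `ε`.
    set δ := min ((G b - mbar - Gbar (p n)) / 2) (γ * ℓ * ε / 8) with hδ
    have hδ0 : 0 < δ := by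
      have := hpG n
      exact lt_min (by linarith) (by positivity)
    have hδ1 : δ ≤ (G b - mbar - Gbar (p n)) / 2 := min_le_left _ _
    have hδ2 : δ ≤ γ * ℓ * ε / 8 := min_le_right _ _
    -- With `lam = 1 / N` the interval `[0, N]` is the unit interval on the scale `1 / lam`.
    have hlim : Tendsto (fun N : ℕ => 1 / (N : ℝ)) atTop (𝓝[>] 0) := by
      refine tendsto_nhdsWithin_iff.2 ⟨tendsto_one_div_atTop_nhds_zero_nat, ?_⟩
      filter_upwards [eventually_gt_atTop 0] with N hN
      have : (0 : ℝ) < N := by exact_mod_cast hN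
      exact one_div_pos.2 this
    obtain ⟨N₀, hN₀⟩ := eventually_atTop.1 (hlim.eventually
      ((h3 1 one_pos δ hδ0).and (h4 1 one_pos δ hδ0)))
    refine ⟨N₀, fun N hN => ?_⟩
    have hNpos : (0 : ℝ) < N := by
      have : 0 < N := by omega
      exact_mod_cast this
    obtain ⟨h5, h6⟩ := hN₀ N hN.le
    have h7 := sum_indicator_highSet_le (V := V) (p := p n) (b := b) (lam := 1 / (N : ℝ))
      (mbar := mbar) (ℓ := ℓ) (δ := δ) (c := Gbar (p n)) (N := N) (one_div_pos.2 hNpos) hK0 hK hmbar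
      (fun y => (h2.1 y).1) hb (hv _ (one_div_pos.2 hNpos)) hℓ hℓ1 (fun y hy => by
        have h8 : 1 / (N : ℝ) * |y| ≤ 1 := by
          rw [abs_of_nonneg hy.1, one_div, inv_mul_le_iff₀ hNpos, mul_one]; exact hy.2
        exact abs_le.2 ⟨by linarith [h6 y h8], by linarith [h5 y h8]⟩)
      (by have := hpG n; linarith)
    rw [Real.dist_eq, sub_zero, abs_of_nonneg (div_nonneg (Finset.sum_nonneg fun i _ => hnn i)
      hNpos.le), div_lt_iff₀ hNpos]
    have h8 : 2 * δ / (1 / (N : ℝ)) = 2 * δ * N := by field_simp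
    rw [h8] at h7
    have h9 : (b - p n) * N + 2 * δ * N < γ * ℓ * (ε * N) := by
      have h10 : b - p n + 2 * δ < γ * ℓ * ε := by
        have := (hp n).1
        have : 0 < γ * ℓ * ε := by positivity
        linarith
      calc _ = (b - p n + 2 * δ) * N := by ring
        _ < γ * ℓ * ε * N := by gcongr
        _ = _ := by ring
    exact lt_of_mul_lt_mul_left (h7.trans_lt h9) (by positivity)
  -- By stationarity every frequency has mean `P E`, while dominated convergence sends these means
  -- to zero.
  have hzero : ∀ ℓ, 0 < ℓ → ℓ ≤ 1 → P (highSet (-mbar / 2) ℓ) = 0 := by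
    intro ℓ hℓ hℓ1
    set E := highSet (-mbar / 2) ℓ with hE
    have hEm : MeasurableSet E := measurableSet_highSet _ _
    have hmeas : Measurable (E.indicator fun _ => (1 : ℝ)) := measurable_const.indicator hEm
    have hind : ∀ V, 0 ≤ E.indicator (fun _ => (1 : ℝ)) V ∧ E.indicator (fun _ => (1 : ℝ)) V ≤ 1 :=
      fun V => ⟨indicator_nonneg (fun _ _ => zero_le_one) _,
        indicator_le_self' (fun _ _ => zero_le_one) _⟩
    have hmeasT : ∀ i : ℕ, Measurable fun V => E.indicator (fun _ => (1 : ℝ)) (translate i V) :=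
      fun i => hmeas.comp (measurable_translate i)
    have hint : ∀ i : ℕ, Integrable (fun V => E.indicator (fun _ => (1 : ℝ)) (translate i V)) P :=
      fun i => Integrable.of_bound (hmeasT i).aestronglyMeasurable 1
        (Eventually.of_forall fun V => by
          rw [Real.norm_eq_abs, abs_of_nonneg (hind _).1]; exact (hind _).2)
    have hval : ∀ i : ℕ, ∫ V, E.indicator (fun _ => (1 : ℝ)) (translate i V) ∂P = P.real E := by
      intro i
      have h1 := integral_map (μ := P) (measurable_translate i).aemeasurable
        (f := E.indicator fun _ => (1 : ℝ)) hmeas.aestronglyMeasurable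
      rw [(hP.measurePreserving i).map_eq] at h1
      rw [← h1, integral_indicator hEm]
      simp
    have hlim := tendsto_integral_of_dominated_convergence (μ := P) (fun _ => (1 : ℝ))
      (F := fun (N : ℕ) V => (∑ i ∈ Finset.range N,
        E.indicator (fun _ => (1 : ℝ)) (translate i V)) / N) (f := fun _ => 0)
      (fun N => ((Finset.measurable_fun_sum (Finset.range N) fun i _ =>
        hmeasT i).div_const (N : ℝ)).aestronglyMeasurable)
      (integrable_const _)
      (fun N => Eventually.of_forall fun V => by
        rw [Real.norm_eq_abs, abs_of_nonneg (div_nonneg (Finset.sum_nonneg fun i _ => (hind _).1)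
          (Nat.cast_nonneg N))]
        refine div_le_one_of_le₀ ?_ (Nat.cast_nonneg N)
        refine (Finset.sum_le_sum fun i _ => (hind _).2).trans ?_
        simp)
      (hfreq ℓ hℓ hℓ1)
    rw [integral_zero] at hlim
    have hconst : ∀ᶠ N : ℕ in atTop, ∫ V, (∑ i ∈ Finset.range N,
        E.indicator (fun _ => (1 : ℝ)) (translate i V)) / N ∂P = P.real E := by
      filter_upwards [eventually_gt_atTop 0] with N hN
      have hNpos : (0 : ℝ) < N := by exact_mod_cast hN
      rw [integral_div, integral_finsetSum _ fun i _ => hint i]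
      simp only [hval, Finset.sum_const, Finset.card_range, nsmul_eq_mul]
      field_simp
    have h0 : P.real E = 0 :=
      tendsto_nhds_unique (tendsto_const_nhds.congr' (EventuallyEq.symm hconst)) hlim
    exact (measureReal_eq_zero_iff (measure_ne_top _ _)).1 h0
  have hnone : ∀ᵐ V ∂P, ∀ (x : ℚ) (j : ℕ),
      translate x V ∉ highSet (-mbar / 2) (1 / ((j : ℝ) + 1)) := by
    simp only [ae_all_iff]
    intro x j
    refine (hP.measurePreserving x).quasiMeasurePreserving.ae
      (p := fun V => V ∉ highSet (-mbar / 2) (1 / ((j : ℝ) + 1))) ?_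
    rw [ae_iff]
    simp only [not_not]
    refine hzero _ (by positivity) ?_
    rw [div_le_one (by positivity)]
    linarith [(Nat.cast_nonneg j : (0 : ℝ) ≤ j)]
  obtain ⟨V, h1, h2⟩ := (hnone.and hP.ae_range).exists
  obtain ⟨y, hy⟩ := h2.2.1 (-mbar / 2) (by linarith)
  obtain ⟨x, j, hxj⟩ := exists_translate_mem_highSet hy
  exact h1 x j hxj

/-! ### The upper bound on either side of the barrier -/

/-- If `-c` dominates in the barrier bound, nothing remains. Otherwise that bound says that `lam *
v` is asymptotically at most `-(H b - mbar) < -H a`, which is what the well argument needs. -/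
theorem scaledLimsupLE_of_lt_well_of_barrier {H G : ℝ → ℝ} {V : BUC} {p a b c mbar K K' : ℝ}
    {v w : ℝ → ℝ → ℝ} (hV : ∀ y, V y ∈ Icc (-mbar) 0)
    (hK : ∀ x y, |G x - G y| ≤ K * |x - y|) (hK' : ∀ x y, |H x - H y| ≤ K' * |x - y|)
    (hcoer : Coercive H) (hHG : ∀ q ≤ b, H q = G q) (hp : p < a) (hab : a ≤ b)
    (ha : H a < H b - mbar)
    (hv : ∀ lam > 0, IsCellSolution H V p lam (v lam))
    (hw : ∀ lam > 0, IsCellSolution G V p lam (w lam))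
    (hw1 : ScaledLimsupLE w (-c)) (hw2 : ScaledLiminfGE w (-c)) : ScaledLimsupLE v (-c) := by
  have h := scaledLimsupLE_of_lt_barrier hV hK hK' hcoer hHG (hp.trans_le hab) hv hw hw1 hw2
  rcases le_or_gt (-(H b - mbar)) (-c) with hc | hc
  · rwa [max_eq_left hc] at h
  · rw [max_eq_right hc.le] at h
    exact scaledLimsupLE_of_lt_well hV hK hK' hHG hp hab hv hw h (by linarith) hw1

theorem abs_sub_le_comp_neg {G : ℝ → ℝ} {K : ℝ} (hK : ∀ x y, |G x - G y| ≤ K * |x - y|) (x y : ℝ) :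
    |G (-x) - G (-y)| ≤ K * |x - y| := by
  have := hK (-x) (-y)
  rwa [neg_sub_neg, abs_sub_comm y x] at this

theorem Coercive.comp_neg {H : ℝ → ℝ} (h : Coercive H) : Coercive fun q => H (-q) :=
  Tendsto.comp h (Homeomorph.neg ℝ).isClosedEmbedding.tendsto_cocompact

theorem ScaledLimsupLE.of_comp_neg {v : ℝ → ℝ → ℝ} {c : ℝ}
    (h : ScaledLimsupLE (fun lam y => v lam (-y)) c) : ScaledLimsupLE v c := by
  simpa using h.comp_neg

theorem scaledLimsupLE_of_gt_barrier {H G : ℝ → ℝ} {V : BUC} {p b c mbar K K' : ℝ}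
    {v w : ℝ → ℝ → ℝ} (hV : ∀ y, V y ∈ Icc (-mbar) 0)
    (hK : ∀ x y, |G x - G y| ≤ K * |x - y|) (hK' : ∀ x y, |H x - H y| ≤ K' * |x - y|)
    (hcoer : Coercive H) (hHG : ∀ q ≥ b, H q = G q) (hp : b < p)
    (hv : ∀ lam > 0, IsCellSolution H V p lam (v lam))
    (hw : ∀ lam > 0, IsCellSolution G V p lam (w lam))
    (hw1 : ScaledLimsupLE w (-c)) (hw2 : ScaledLiminfGE w (-c)) :
    ScaledLimsupLE v (max (-c) (-(H b - mbar))) := by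
  have h := scaledLimsupLE_of_lt_barrier (V := reflect V) (b := -b) (p := -p)
    (fun y => hV (-y)) (abs_sub_le_comp_neg hK) (abs_sub_le_comp_neg hK') hcoer.comp_neg
    (fun q hq => hHG (-q) (by linarith)) (by linarith) (fun lam hlam => (hv lam hlam).reflect)
    (fun lam hlam => (hw lam hlam).reflect) hw1.comp_neg hw2.comp_neg
  rw [neg_neg] at h
  exact h.of_comp_neg

theorem scaledLimsupLE_of_gt_well_of_barrier {H G : ℝ → ℝ} {V : BUC} {p a b c mbar K K' : ℝ}
    {v w : ℝ → ℝ → ℝ} (hV : ∀ y, V y ∈ Icc (-mbar) 0)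
    (hK : ∀ x y, |G x - G y| ≤ K * |x - y|) (hK' : ∀ x y, |H x - H y| ≤ K' * |x - y|)
    (hcoer : Coercive H) (hHG : ∀ q ≥ b, H q = G q) (hp : a < p) (hab : b ≤ a)
    (ha : H a < H b - mbar)
    (hv : ∀ lam > 0, IsCellSolution H V p lam (v lam))
    (hw : ∀ lam > 0, IsCellSolution G V p lam (w lam))
    (hw1 : ScaledLimsupLE w (-c)) (hw2 : ScaledLiminfGE w (-c)) : ScaledLimsupLE v (-c) := by
  have h := scaledLimsupLE_of_lt_well_of_barrier (V := reflect V) (a := -a) (b := -b) (p := -p)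
    (fun y => hV (-y)) (abs_sub_le_comp_neg hK) (abs_sub_le_comp_neg hK') hcoer.comp_neg
    (fun q hq => hHG (-q) (by linarith)) (by linarith) (by linarith) (by simpa using ha)
    (fun lam hlam => (hv lam hlam).reflect)
    (fun lam hlam => (hw lam hlam).reflect) hw1.comp_neg hw2.comp_neg
  exact h.of_comp_neg

/-! ### The shape of the Hamiltonian -/

/-- On each monotone piece `H` is at most the value at the adjacent bump; the pieces are added one
well at a time from the right. -/
theorem IsWellProfile.le_of_mem_Icc {H : ℝ → ℝ} {L : ℕ} {pt : ℕ → ℝ} {M : ℝ}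
    (hH : IsWellProfile H L pt) (hL : 1 ≤ L) (hM : ∀ i ∈ Icc 1 L, H (pt (2 * i)) ≤ M) {q : ℝ}
    (hq : q ∈ Icc 0 (pt 1)) : H q ≤ M := by
  have hlt : ∀ i j, 1 ≤ i → i < j → j ≤ 2 * L + 1 → pt j < pt i := fun i j h1 h2 h3 =>
    hH.pt_anti ⟨h1, by omega⟩ ⟨by omega, h3⟩ h2
  have key : ∀ i ≤ L, ∀ q ∈ Icc (pt (2 * i + 1)) (pt 1), H q ≤ M := by
    intro i
    induction i with
    | zero =>
      intro _ q hq
      have h1 := hlt 1 2 le_rfl (by omega) (by omega)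
      have h2 : q = pt 1 := le_antisymm hq.2 hq.1
      have h3 := (hH.anti 1 ⟨le_rfl, hL⟩).antitoneOn (a := pt (2 * 1)) (b := pt (2 * 1 - 1))
        ⟨le_rfl, h1.le⟩ ⟨h1.le, le_rfl⟩ h1.le
      rw [h2]
      exact h3.trans (hM 1 ⟨le_rfl, hL⟩)
    | succ i ih =>
      intro hi q hq
      have hmem : i + 1 ∈ Icc 1 L := ⟨by omega, hi⟩
      have h1 := hlt (2 * (i + 1)) (2 * (i + 1) + 1) (by omega) (by omega) (by omega)
      have h2 := hlt (2 * i + 1) (2 * (i + 1)) (by omega) (by omega) (by omega)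
      rcases le_total (pt (2 * i + 1)) q with h | h
      · exact ih (by omega) q ⟨h, hq.2⟩
      rcases le_total (pt (2 * (i + 1))) q with h' | h'
      · exact ((hH.anti _ hmem).antitoneOn ⟨le_rfl, h2.le⟩ ⟨h', h⟩ h').trans (hM _ hmem)
      · exact ((hH.mono _ hmem).monotoneOn ⟨hq.1, h'⟩ ⟨h1.le, le_rfl⟩ h').trans (hM _ hmem)
  exact key L le_rfl q (by rw [hH.pt_last]; exact hq)

theorem le_of_strictMonoOn_Ioi {G : ℝ → ℝ} {b : ℝ} (hc : Continuous G)
    (h : StrictMonoOn G (Ioi b)) {q : ℝ} (hq : b ≤ q) : G b ≤ G q := by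
  rcases hq.eq_or_lt with rfl | hq
  · exact le_rfl
  refine le_of_tendsto ((hc.tendsto b).mono_left (nhdsWithin_le_nhds (s := Ioi b))) ?_
  filter_upwards [Ioo_mem_nhdsGT hq] with t ht using (h ht.1 hq ht.2).le

theorem le_of_strictAntiOn_Iio {G : ℝ → ℝ} {b : ℝ} (hc : Continuous G)
    (h : StrictAntiOn G (Iio b)) {q : ℝ} (hq : q ≤ b) : G b ≤ G q := by
  rcases hq.eq_or_lt with rfl | hq
  · exact le_rfl
  refine le_of_tendsto ((hc.tendsto b).mono_left (nhdsWithin_le_nhds (s := Iio b))) ?_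
  filter_upwards [Ioo_mem_nhdsLT hq] with t ht using (h hq ht.2 ht.1).le

end HJ

/-! ### Gluing the two effective Hamiltonians -/

theorem mainTheorem6
    (P : Measure BUC) (mbar : ℝ) (hP : IsAdmissibleLaw P mbar) (hV : HasDiscreteLevels P)
    (H : ℝ → ℝ) (L : ℕ) (pt : ℕ → ℝ) (hH : IsWellProfile H L pt)
    -- `M_k` is the largest local maximum and `m_l` the smallest local minimum on `(0, ∞)`
    (k l : ℕ) (hk : k ∈ Icc 1 L) (hl : l ∈ Icc 1 L)
    (hkmax : ∀ i ∈ Icc 1 L, H (pt (2 * i)) ≤ H (pt (2 * k)))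
    (hlmin : ∀ i ∈ Icc 1 L, H (pt (2 * l - 1)) ≤ H (pt (2 * i - 1)))
    (hosc : mbar < H (pt (2 * k)) - H (pt (2 * l - 1)))
    (hlk : l ≤ k)
    (H₁ : ℝ → ℝ) (hH₁lip : ∃ K, LipschitzWith K H₁) (hH₁coer : Coercive H₁)
    (hH₁nonneg : ∀ q, 0 ≤ H₁ q) (hH₁ge : ∀ q, H q ≤ H₁ q)
    (hH₁eq : EqOn H₁ H (Iic (pt (2 * k)))) (hH₁mono : StrictMonoOn H₁ (Ioi (pt (2 * k))))
    (H₂ : ℝ → ℝ) (hH₂lip : ∃ K, LipschitzWith K H₂) (hH₂coer : Coercive H₂)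
    (hH₂lower : ∀ q, H (pt (2 * l - 1)) ≤ H₂ q) (hH₂ge : ∀ q, H q ≤ H₂ q)
    (hH₂eq : EqOn H₂ H (Ici (pt (2 * k)))) (hH₂anti : StrictAntiOn H₂ (Iio (pt (2 * k))))
    (Hbar₁ Hbar₂ : ℝ → ℝ)
    (hHbar₁ : IsEffectiveHamiltonian P H₁ Hbar₁)
    (hHbar₂ : IsEffectiveHamiltonian P H₂ Hbar₂) :
    ∃ Hbar : ℝ → ℝ, IsEffectiveHamiltonian P H Hbar ∧
      (∀ p ≤ 0, Hbar p = Hbar₁ p) ∧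
      (∀ p ∈ Icc 0 (pt (2 * l - 1)),
        Hbar p = min (min (Hbar₁ p) (Hbar₂ p)) (H (pt (2 * k)) - mbar)) ∧
      (∀ p ≥ pt (2 * l - 1), Hbar p = Hbar₂ p) ∧
      -- the flat piece
      (∃ q₁ q₂ : ℝ, 0 ≤ q₁ ∧ q₁ < q₂ ∧ q₂ ≤ pt (2 * l - 1) ∧
        ∀ p ∈ Icc q₁ q₂, Hbar p = H (pt (2 * k)) - mbar) := by
  obtain ⟨hk1, hkL⟩ := hk
  obtain ⟨hl1, hlL⟩ := hl
  have hlt : ∀ i j, 1 ≤ i → i < j → j ≤ 2 * L + 1 → pt j < pt i := fun i j h1 h2 h3 =>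
    hH.pt_anti ⟨h1, by omega⟩ ⟨by omega, h3⟩ h2
  have hb0 : 0 < pt (2 * k) := by
    rw [← hH.pt_last]; exact hlt _ _ (by omega) (by omega) le_rfl
  have hba : pt (2 * k) < pt (2 * l - 1) := hlt _ _ (by omega) (by omega) (by omega)
  have ha1 : pt (2 * l - 1) ≤ pt 1 := by
    rcases (show 1 ≤ 2 * l - 1 by omega).eq_or_lt with h | h
    · rw [← h]
    · exact (hlt _ _ le_rfl h (by omega)).le
  have hma : 0 < H (pt (2 * l - 1)) := hH.values_pos _ ⟨by omega, by omega⟩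
  set a := pt (2 * l - 1) with ha
  set b := pt (2 * k) with hb
  have hM : ∀ q ∈ Icc 0 a, H q ≤ H b := fun q hq =>
    hH.le_of_mem_Icc (hk1.trans hkL) hkmax ⟨hq.1, hq.2.trans ha1⟩
  obtain ⟨K, hK0, hK⟩ := real_lipschitz hH.lipschitz
  obtain ⟨K₁, hK₁0, hK₁⟩ := real_lipschitz hH₁lip
  obtain ⟨K₂, hK₂0, hK₂⟩ := real_lipschitz hH₂lip
  have hmbar := hP.mbar_pos
  have h1b : H₁ b = H b := hH₁eq (mem_Iic.2 le_rfl)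
  have h2b : H₂ b = H b := hH₂eq (mem_Ici.2 le_rfl)
  have h10 : H₁ 0 = 0 := (hH₁eq (mem_Iic.2 hb0.le)).trans hH.map_zero
  have h2a : H₂ a = H a := hH₂eq (mem_Ici.2 hba.le)
  have h1ge : ∀ q ≥ b, H₁ b ≤ H₁ q := fun q hq =>
    le_of_strictMonoOn_Ioi hH₁lip.choose_spec.continuous hH₁mono hq
  have h2ge : ∀ q ≤ b, H₂ b ≤ H₂ q := fun q hq =>
    le_of_strictAntiOn_Iio hH₂lip.choose_spec.continuous hH₂anti hq
  have hc1 : ∀ p ≥ b, H b - mbar ≤ Hbar₁ p := fun p hp => by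
    have := ((hHbar₁ p).mem_Icc hP hK₁).1
    linarith [h1ge p hp]
  have hc2 : ∀ p ≤ b, H b - mbar ≤ Hbar₂ p := fun p hp => by
    have := ((hHbar₂ p).mem_Icc hP hK₂).1
    linarith [h2ge p hp]
  have hc10 : Hbar₁ 0 ≤ 0 := ((hHbar₁ 0).mem_Icc hP hK₁).2.trans_eq h10
  have hc2a : Hbar₂ a ≤ H a := ((hHbar₂ a).mem_Icc hP hK₂).2.trans_eq h2a
  set Hbar : ℝ → ℝ := fun p => if p ≤ 0 then Hbar₁ p else if p < a then
    min (min (Hbar₁ p) (Hbar₂ p)) (H b - mbar) else Hbar₂ p with hHbar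
  have hleft : ∀ p ≤ 0, Hbar p = Hbar₁ p := fun p hp => by simp only [hHbar, if_pos hp]
  have hright : ∀ p ≥ a, Hbar p = Hbar₂ p := fun p hp => by
    simp only [hHbar, if_neg (not_le.2 ((hb0.trans hba).trans_le hp)), if_neg (not_lt.2 hp)]
  -- The formulas agree at the end points: `Hbar₁ 0 ≤ 0` and `Hbar₂ a ≤ H a` lie below `H b - mbar`,
  -- which bounds the other effective Hamiltonian from below there.
  have hmid : ∀ p ∈ Icc 0 a, Hbar p = min (min (Hbar₁ p) (Hbar₂ p)) (H b - mbar) := by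
    rintro p ⟨h0, h1⟩
    rcases h0.eq_or_lt with rfl | h0
    · have := hc2 0 hb0.le
      rw [hleft 0 le_rfl, min_eq_left (by linarith : Hbar₁ 0 ≤ Hbar₂ 0),
        min_eq_left (by linarith)]
    rcases h1.eq_or_lt with rfl | h1
    · have := hc1 a hba.le
      rw [hright a le_rfl, min_eq_right (by linarith : Hbar₂ a ≤ Hbar₁ a),
        min_eq_left (by linarith)]
    · simp only [hHbar, if_neg (not_le.2 h0), if_pos h1]
  refine ⟨Hbar, fun p => ?_, hleft, hmid, hright, ?_⟩
  · have hae : ∀ᵐ V ∂P, ∀ v : ℝ → ℝ → ℝ, (∀ lam > 0, IsCellSolution H V p lam (v lam)) →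
        ScaledLimsupLE v (-Hbar p) ∧ ScaledLiminfGE v (-Hbar p) := by
      filter_upwards [hP.ae_range, hP.ae_hasDenseMinima, (hHbar₁ p).ae_scaled,
        (hHbar₂ p).ae_scaled] with V hVr hVmin hV1 hV2 v hv
      obtain ⟨w₁, hw₁⟩ := (hHbar₁ p).exists_family V
      obtain ⟨w₂, hw₂⟩ := (hHbar₂ p).exists_family V
      obtain ⟨hs1, hi1⟩ := hV1 w₁ hw₁
      obtain ⟨hs2, hi2⟩ := hV2 w₂ hw₂
      have hle1 : ∀ lam > 0, ∀ y, w₁ lam y ≤ v lam y := fun lam hlam =>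
        (hv lam hlam).le_of_le hlam hK hH₁ge (hw₁ lam hlam)
      have hle2 : ∀ lam > 0, ∀ y, w₂ lam y ≤ v lam y := fun lam hlam =>
        (hv lam hlam).le_of_le hlam hK hH₂ge (hw₂ lam hlam)
      have heq1 : ∀ q ≤ b, H q = H₁ q := fun q hq => (hH₁eq hq).symm
      have heq2 : ∀ q ≥ b, H q = H₂ q := fun q hq => (hH₂eq hq).symm
      have hltb : p < b → ScaledLimsupLE v (max (-Hbar₁ p) (-(H b - mbar))) := fun hpb =>
        scaledLimsupLE_of_lt_barrier hVr.1 hK₁ hK hH.coercive heq1 hpb hv hw₁ hs1 hi1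
      have hgtb : b < p → ScaledLimsupLE v (max (-Hbar₂ p) (-(H b - mbar))) := fun hpb =>
        scaledLimsupLE_of_gt_barrier hVr.1 hK₂ hK hH.coercive heq2 hpb hv hw₂ hs2 hi2
      rcases le_or_gt p 0 with hp0 | hp0
      · rw [hleft p hp0]
        refine ⟨?_, hi1.mono hle1 le_rfl⟩
        -- The well argument needs `p` strictly to the left of the well. At `p = 0` the barrier
        -- bound suffices, since `Hbar₁ 0 ≤ 0 < H b - mbar`.
        rcases hp0.eq_or_lt with rfl | hp0
        · exact (hltb hb0).mono (fun _ _ _ => le_rfl) (max_le le_rfl (by linarith))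
        · exact scaledLimsupLE_of_lt_well_of_barrier hVr.1 hK₁ hK hH.coercive heq1 hp0 hb0.le
            (by rw [hH.map_zero]; linarith) hv hw₁ hs1 hi1
      rcases le_or_gt a p with hpa | hpa
      · rw [hright p hpa]
        refine ⟨?_, hi2.mono hle2 le_rfl⟩
        rcases hpa.eq_or_lt with rfl | hpa
        · exact (hgtb hba).mono (fun _ _ _ => le_rfl) (max_le le_rfl (by linarith))
        · exact scaledLimsupLE_of_gt_well_of_barrier hVr.1 hK₂ hK hH.coercive heq2 hpa hba.le
            (by linarith) hv hw₂ hs2 hi2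
      rw [hmid p ⟨hp0.le, hpa.le⟩]
      have htent : ScaledLiminfGE v (-(H b - mbar)) :=
        scaledLiminfGE_of_hasDenseMinima hK (fun y => (hVr.1 y).2) hVmin hv hp0 hpa
          (by rw [hH.map_zero]; linarith) (by linarith) hM
      refine ⟨?_, ?_⟩
      · rcases lt_trichotomy p b with hpb | hpb | hpb
        · refine (hltb hpb).mono (fun _ _ _ => le_rfl) (max_le ?_ ?_)
          · exact neg_le_neg ((min_le_left _ _).trans (min_le_left _ _))
          · exact neg_le_neg (min_le_right _ _)
        -- At the barrier itself a constant supersolution gives the bound.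
        · have h : ScaledLimsupLE v (-(H p - mbar)) := ScaledLimsupLE.of_forall fun lam hlam y =>
            (hv lam hlam).le_neg hlam hK (fun y => (hVr.1 y).1) y
          rw [hpb] at h ⊢
          exact h.mono (fun _ _ _ => le_rfl) (neg_le_neg (min_le_right _ _))
        · refine (hgtb hpb).mono (fun _ _ _ => le_rfl) (max_le ?_ ?_)
          · exact neg_le_neg ((min_le_left _ _).trans (min_le_right _ _))
          · exact neg_le_neg (min_le_right _ _)
      -- Whichever of the three terms is the minimum, its own lower bound for `v` is the one
      -- required.
      · rcases min_choice (min (Hbar₁ p) (Hbar₂ p)) (H b - mbar) with h | h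
        · rw [h]
          rcases min_choice (Hbar₁ p) (Hbar₂ p) with h' | h'
          · rw [h']; exact hi1.mono hle1 le_rfl
          · rw [h']; exact hi2.mono hle2 le_rfl
        · rw [h]; exact htent
    exact
      { law := ⟨mbar, hP⟩
        continuous := hH.lipschitz.choose_spec.continuous
        coercive := hH.coercive
        wellPosed := fun V lam hlam => existsUnique_isCellSolution hH.lipschitz hH.coercive V p hlam
        tendsto := fun R hR => by
          filter_upwards [hae] with V hVs v hv
          exact tendsto_of_scaled hR (hVs v hv).1 (hVs v hv).2 }
  · obtain ⟨e, he, hflat⟩ := hHbar₁.exists_le_left_of_barrier hP hK₁0 hK₁ h1ge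
    refine ⟨max 0 (b - e), b, le_max_left _ _, max_lt hb0 (by linarith), hba.le, fun p hp => ?_⟩
    have h1 := (le_max_left _ _).trans hp.1
    have h2 := (le_max_right _ _).trans hp.1
    rw [hmid p ⟨h1, hp.2.trans hba.le⟩, min_eq_right]
    exact le_min (h1b ▸ hflat p ⟨h2, hp.2⟩) (hc2 p hp.2)
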